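/- Let $N\ge 1$ be a fixed number of agents. An instance of goods consists of a finite set $\mathcal M$ of items and additive utility functions $u_1,\dots,u_N:\mathcal P(\mathcal M)\to\mathbb R_{\ge 0}$. An allocation is an ordered partition $S=(S_1,\dots,S_N)$ of $\mathcal M$ into possibly empty bundles. Let $\mathrm{MmS}_i=\max_{S}\min_{k} u_i(S_k)$, the maximum being over all allocations. For $\lambda\in[0,\infty]$ (with $\infty\cdot 0=0$), $S$ solves the $\lambda$-max-min problem if $u_i(S_i)\ge\lambda\cdot\mathrm{MmS}_i$ for all $i$. The optimal MmS ratio $\lambda^I$ of an instance $I$ is the largest $\lambda\in[0,\infty]$ for which the $\lambda$-max-min problem has a solution; an allocation is an optimal MmS allocation if it solves the $\lambda^I$-max-min problem, and an MmS allocation if it solves the $1$-max-min problem. Consider the following algorithm for an instance $I$ and $\varepsilon>0$. (1) Select $\alpha,\beta\in(0,1)$ with $\alpha\beta>1-\varepsilon$. (2) Compute $c_i$ with $\alpha\,\mathrm{MmS}_i\le c_i\le \mathrm{MmS}_i$ for each $i$, and put $A=\{i: c_i>0\}$. (3) If $A=\emptyset$, return an arbitrary allocation $S^\varepsilon$. (4)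 Otherwise put $u_i'=u_i/c_i$ for $i\in A$, and let $\lambda^*$ be the maximum of $\min_{i\in A}u_i'(T_i)$ over all ordered partitions $(T_i)_{i\in A}$ of $\mathcal M$. Compute an ordered partition $(S_i^\varepsilon)_{i\in A}$ of $\mathcal M$ with $u_i'(S_i^\varepsilon)\ge\beta\lambda^*$ for all $i\in A$, put $S_i^\varepsilon=\emptyset$ for $i\notin A$, and return $S^\varepsilon=(S_1^\varepsilon,\dots,S_N^\varepsilon)$. Then the following hold. (a) For all instances $I$ with $N$ agents and real utilities and all $\varepsilon>0$, the algorithm has an execution, and for every execution the returned allocation $S^\varepsilon$ solves the $((1-\varepsilon)\lambda^I)$-max-min problem. If $I$ has an MmS allocation, $S^\varepsilon$ also solves the $(1-\varepsilon)$-max-min problem. (For $\varepsilon\ge1$ the ratio $1-\varepsilon$ is replaced by $0$, which requires nothing.) (b) There is one program (for a random access machine with logarithmic cost, depending on $N$ only) that, on input a rational $\varepsilon>0$ and an instance with $N$ agents and non-negative rational utilities given in binary, carries out the algorithm, that is, halts with the $\alpha,\beta,c_1,\dots,c_N,S^\varepsilon$ of an execution; and for each fixed $\varepsilon$ its running time is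 bounded by a polynomial in the input length. Consequently this program is a polynomial-time approximation scheme (PTAS) for computing an optimal MmS allocation of goods, and, on the instances for which an MmS allocation exists, a PTAS for computing an MmS allocation. -/

import Mathlib

open scoped NNReal ENNReal

noncomputable section

namespace GoodsMmS

/-! ### Fair division of goods

`M` is the finite set of items, `ι` a set of agents (or of machines).  An additive utility function
with values in `ℝ≥0` is given by its values `u i j` on single items, and an ordered partition
`(S_i)` of `M` into possibly empty bundles is given by the map sending each item to the agent that
receives it. -/

variable {ι M : Type*} [DecidableEq ι] [Fintype M] {N : ℕ}

/-- The bundle `S_i` of agent `i` in the allocation `S`. -/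
def bundle (S : M → ι) (i : ι) : Finset M := Finset.univ.filter fun j => S j = i

/-- The value `v (B)` of a set `B` of items for the additive utility function `v`. -/
def value (v : M → ℝ≥0) (B : Finset M) : ℝ≥0 := ∑ j ∈ B, v j

/-- The max-min share guarantee of agent `i`:
the maximum over all `N`-partitions of the minimum over `k` of `u_i (S_k)`. -/
def mms (u : Fin N → M → ℝ≥0) (i : Fin N) : ℝ≥0 :=
  ⨆ S : M → Fin N, ⨅ k : Fin N, value (u i) (bundle S k)

/-- `S` is an MmS allocation: `u_i (S_i) ≥ MmS_i` for all agents `i`. -/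
def IsMmSAllocation (u : Fin N → M → ℝ≥0) (S : M → Fin N) : Prop :=
  ∀ i, mms u i ≤ value (u i) (bundle S i)

/-- `S` solves the `lam`-max-min problem: `u_i (S_i) ≥ lam * MmS_i` for all `i`.
Here `lam` lies in `[0, ∞]`, with `∞ * 0 = 0`. -/
def SolvesMaxMin (u : Fin N → M → ℝ≥0) (lam : ℝ≥0∞) (S : M → Fin N) : Prop :=
  ∀ i, lam * (mms u i : ℝ≥0∞) ≤ (value (u i) (bundle S i) : ℝ≥0∞)

/-- The optimal MmS ratio: the maximal `lam` in `[0, ∞]` for which the `lam`-max-min problem has a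
solution (`optRatio_isGreatest` shows that the maximum is attained). An optimal MmS allocation is
an allocation `S` with `SolvesMaxMin u (optRatio u) S`. -/
def optRatio (u : Fin N → M → ℝ≥0) : ℝ≥0∞ :=
  sSup {lam : ℝ≥0∞ | ∃ S : M → Fin N, SolvesMaxMin u lam S}

theorem optRatio_isGreatest (hN : 0 < N) (u : Fin N → M → ℝ≥0) :
    IsGreatest {lam : ℝ≥0∞ | ∃ S : M → Fin N, SolvesMaxMin u lam S} (optRatio u) := by
  refine ⟨?_, fun x hx => le_sSup hx⟩
  have hne : {lam : ℝ≥0∞ | ∃ S : M → Fin N, SolvesMaxMin u lam S}.Nonempty :=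
    ⟨0, fun _ => ⟨0, hN⟩, fun i => by simp⟩
  refine IsClosed.csSup_mem ?_ hne (OrderTop.bddAbove _)
  have h : {lam : ℝ≥0∞ | ∃ S : M → Fin N, SolvesMaxMin u lam S} =
      ⋃ S : M → Fin N, ⋂ i : Fin N,
        {lam : ℝ≥0∞ | lam * (mms u i : ℝ≥0∞) ≤ (value (u i) (bundle S i) : ℝ≥0∞)} := by
    ext lam
    simp [SolvesMaxMin]
  rw [h]
  exact isClosed_iUnion_of_finite fun S => isClosed_iInter fun i =>
    isClosed_le (ENNReal.continuous_mul_const ENNReal.coe_ne_top) continuous_const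

/-! ### The approximation algorithm -/

/-- The optimal value of `R/C_min`: maximize the earliest finishing time over all schedules `T` of
the jobs `M` on the machines `ι`, where `p i j` is the processing time of job `j` on machine `i`. -/
def cMin (p : ι → M → ℝ≥0) : ℝ≥0 := ⨆ T : M → ι, ⨅ i : ι, value (p i) (bundle T i)

/-- The data chosen and computed in one execution of the algorithm. -/
structure Run (N : ℕ) (M : Type*) where
  /-- accuracy of the computation of the shares -/
  α : ℝ≥0
  /-- accuracy of the scheduling step -/
  β : ℝ≥0
  /-- the approximate shares -/
  c : Fin N → ℝ≥0
  /-- the returned allocation -/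
  S : M → Fin N

/-- `r` is an execution of the algorithm for the instance `u` and the accuracy `ε`:
`α, β ∈ (0, 1)` with `α * β > 1 - ε` are selected; values `c_i` with
`α * MmS_i ≤ c_i ≤ MmS_i` are computed; if all `c_i` are zero then the returned allocation is
arbitrary; otherwise it is a `β`-approximate solution `T` of the `R/C_min` problem whose machines
are the agents with `c_i > 0` and whose processing times are `u_i (j) / c_i`
(the other agents receive nothing). -/
def IsRun (u : Fin N → M → ℝ≥0) (ε : ℝ≥0) (r : Run N M) : Prop :=
  (0 < r.α ∧ r.α < 1) ∧ (0 < r.β ∧ r.β < 1) ∧ 1 - (ε : ℝ) < (r.α : ℝ) * (r.β : ℝ) ∧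
  (∀ i, r.α * mms u i ≤ r.c i ∧ r.c i ≤ mms u i) ∧
  ((∃ i, 0 < r.c i) →
    let p : {i : Fin N // 0 < r.c i} → M → ℝ≥0 := fun i j => 1 / r.c i * u i j
    ∃ T : M → {i : Fin N // 0 < r.c i},
      (∀ i, r.β * cMin p ≤ value (p i) (bundle T i)) ∧ ∀ j, r.S j = (T j : Fin N))

/-! ### Model of computation

Random access programs with finitely many arrays of natural numbers and logarithmic cost: every
operation is charged for the bit lengths of the numbers and of the addresses that it handles. -/

/-- `σ a k` is the content of cell `k` of array `a`. -/
abbrev State := ℕ → ℕ → ℕ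

/-- Bit length plus one. -/
def bits (n : ℕ) : ℕ := Nat.size n + 1

/-- Expressions; `read a e` is the content of cell `e` of array `a`, `sub` is truncated
subtraction, and `div` is the integer quotient (zero if the divisor is zero). -/
inductive Expr where
  | const (n : ℕ)
  | read (a : ℕ) (e : Expr)
  | add (e f : Expr)
  | sub (e f : Expr)
  | mul (e f : Expr)
  | div (e f : Expr)

/-- Value of an expression. -/
def Expr.eval (σ : State) : Expr → ℕ
  | .const n => n
  | .read a e => σ a (e.eval σ)
  | .add e f => e.eval σ + f.eval σ
  | .sub e f => e.eval σ - f.eval σ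
  | .mul e f => e.eval σ * f.eval σ
  | .div e f => e.eval σ / f.eval σ

/-- Cost of evaluating an expression. -/
def Expr.cost (σ : State) : Expr → ℕ
  | .const n => bits n
  | .read a e => e.cost σ + bits (e.eval σ) + bits (σ a (e.eval σ))
  | .add e f => e.cost σ + f.cost σ + bits (e.eval σ) + bits (f.eval σ)
  | .sub e f => e.cost σ + f.cost σ + bits (e.eval σ) + bits (f.eval σ)
  | .mul e f => e.cost σ + f.cost σ + bits (e.eval σ) * bits (f.eval σ)
  | .div e f => e.cost σ + f.cost σ + bits (e.eval σ) * bits (f.eval σ)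

/-- Programs; `write a e f` stores the value of `f` in cell `e` of array `a`, and a condition holds
if its value is not zero. -/
inductive Prog where
  | skip
  | write (a : ℕ) (e f : Expr)
  | seq (P Q : Prog)
  | cond (e : Expr) (P Q : Prog)
  | loop (e : Expr) (P : Prog)

/-- The state after storing `v` in cell `k` of array `a`. -/
def State.set (σ : State) (a k v : ℕ) : State :=
  Function.update σ a (Function.update (σ a) k v)

/-- `Exec P σ τ t`: started in the state `σ`, the program `P` halts in the state `τ`, at total
cost `t`. -/
inductive Exec : Prog → State → State → ℕ → Prop where
  | skip (σ : State) : Exec .skip σ σ 1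
  | write (a : ℕ) (e f : Expr) (σ : State) :
      Exec (.write a e f) σ (σ.set a (e.eval σ) (f.eval σ))
        (e.cost σ + f.cost σ + bits (e.eval σ) + bits (f.eval σ))
  | seq {P Q : Prog} {σ τ ρ : State} {s t : ℕ} (h₁ : Exec P σ τ s) (h₂ : Exec Q τ ρ t) :
      Exec (.seq P Q) σ ρ (s + t + 1)
  | condTrue {e : Expr} {P Q : Prog} {σ τ : State} {t : ℕ} (he : e.eval σ ≠ 0)
      (h : Exec P σ τ t) : Exec (.cond e P Q) σ τ (e.cost σ + t + 1)
  | condFalse {e : Expr} {P Q : Prog} {σ τ : State} {t : ℕ} (he : e.eval σ = 0)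
      (h : Exec Q σ τ t) : Exec (.cond e P Q) σ τ (e.cost σ + t + 1)
  | loopStop {e : Expr} {P : Prog} {σ : State} (he : e.eval σ = 0) :
      Exec (.loop e P) σ σ (e.cost σ + 1)
  | loopStep {e : Expr} {P : Prog} {σ τ ρ : State} {s t : ℕ} (he : e.eval σ ≠ 0)
      (h₁ : Exec P σ τ s) (h₂ : Exec (.loop e P) τ ρ t) :
      Exec (.loop e P) σ ρ (e.cost σ + s + t + 1)

/-- Programs are deterministic. -/
theorem Exec.unique {P : Prog} {σ τ τ' : State} {t t' : ℕ} (h : Exec P σ τ t)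
    (h' : Exec P σ τ' t') : τ = τ' ∧ t = t' := by
  induction h generalizing τ' t' with
  | skip => cases h'; exact ⟨rfl, rfl⟩
  | write => cases h'; exact ⟨rfl, rfl⟩
  | seq _ _ ih₁ ih₂ =>
    cases h' with
    | seq g₁ g₂ =>
      obtain ⟨rfl, rfl⟩ := ih₁ g₁
      obtain ⟨rfl, rfl⟩ := ih₂ g₂
      exact ⟨rfl, rfl⟩
  | condTrue he _ ih =>
    cases h' with
    | condTrue _ g => obtain ⟨rfl, rfl⟩ := ih g; exact ⟨rfl, rfl⟩
    | condFalse he' _ => exact absurd he' he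
  | condFalse he _ ih =>
    cases h' with
    | condTrue he' _ => exact absurd he he'
    | condFalse _ g => obtain ⟨rfl, rfl⟩ := ih g; exact ⟨rfl, rfl⟩
  | loopStop he =>
    cases h' with
    | loopStop _ => exact ⟨rfl, rfl⟩
    | loopStep he' _ _ => exact absurd he he'
  | loopStep he _ _ ih₁ ih₂ =>
    cases h' with
    | loopStop he' => exact absurd he' he
    | loopStep _ g₁ g₂ =>
      obtain ⟨rfl, rfl⟩ := ih₁ g₁
      obtain ⟨rfl, rfl⟩ := ih₂ g₂
      exact ⟨rfl, rfl⟩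

/-! ### Input and output -/

/-- A rational instance as an instance with real utilities. -/
def toReal {m : ℕ} (u : Fin N → Fin m → ℚ≥0) : Fin N → Fin m → ℝ≥0 := fun i j => (u i j : ℝ≥0)

/-- The input for the accuracy `ε` and the rational instance `u`: numerator and denominator of `ε`,
the number of items, then numerator and denominator of all utilities, agent by agent. -/
def encode {m : ℕ} (ε : ℚ≥0) (u : Fin N → Fin m → ℚ≥0) : List ℕ :=
  [ε.num, ε.den, m] ++
    (List.finRange N).flatMap fun i => (List.finRange m).flatMap fun j => [(u i j).num, (u i j).den]

/-- Length of an input, with its numbers written in binary. -/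
def inputSize (L : List ℕ) : ℕ := (L.map bits).sum

/-- The initial state: array `0` holds the input, all other cells are zero. -/
def initState (L : List ℕ) : State := fun a k => if a = 0 then L.getD k 0 else 0

/-- The allocation that a final state holds: cell `j` of array `2` is the agent receiving `j`. -/
def OutputsAllocation {m : ℕ} (σ : State) (S : Fin m → Fin N) : Prop :=
  ∀ j : Fin m, σ 2 (j : ℕ) = (S j : ℕ)

/-- The `k`-th fraction stored in array `1`. -/
def frac (σ : State) (k : ℕ) : ℝ≥0 := (σ 1 (2 * k) : ℝ≥0) / (σ 1 (2 * k + 1) : ℝ≥0)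

/-- The final state holds the data of the execution `r`: array `1` holds `α`, `β` and the `c_i` as
fractions, array `2` holds the allocation. -/
def OutputsRun {m : ℕ} (σ : State) (r : Run N (Fin m)) : Prop :=
  (∀ k < N + 2, σ 1 (2 * k + 1) ≠ 0) ∧ r.α = frac σ 0 ∧ r.β = frac σ 1 ∧
    (∀ i : Fin N, r.c i = frac σ ((i : ℕ) + 2)) ∧ OutputsAllocation σ r.S

/-- The program `P` carries out the algorithm on all rational instances with `N` agents, and for
each fixed `ε > 0` its running time is polynomial in the input length. -/
def ImplementsInPolyTime (N : ℕ) (P : Prog) : Prop :=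
  ∀ ε : ℚ≥0, 0 < ε → ∃ q : Polynomial ℕ, ∀ (m : ℕ) (u : Fin N → Fin m → ℚ≥0),
    ∃ (σ : State) (t : ℕ), Exec P (initState (encode ε u)) σ t ∧
      t ≤ q.eval (inputSize (encode ε u)) ∧
      ∃ r : Run N (Fin m), IsRun (toReal u) (ε : ℝ≥0) r ∧ OutputsRun σ r

/-- The program `P` is a polynomial-time approximation scheme, on the rational instances with `N`
agents in the class `K`, for computing an allocation that achieves the ratio `target`: for each
fixed `ε > 0` it runs in time polynomial in the input length, and it returns a solution of the
`((1 - ε) * target)`-max-min problem. (For `ε ≥ 1` the truncated difference is `0`; then nothing is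
required of the allocation, since utilities are non-negative.) -/
def IsPTAS (N : ℕ) (P : Prog) (K : ∀ m : ℕ, (Fin N → Fin m → ℝ≥0) → Prop)
    (target : ∀ m : ℕ, (Fin N → Fin m → ℝ≥0) → ℝ≥0∞) : Prop :=
  ∀ ε : ℚ≥0, 0 < ε → ∃ q : Polynomial ℕ, ∀ (m : ℕ) (u : Fin N → Fin m → ℚ≥0), K m (toReal u) →
    ∃ (σ : State) (t : ℕ), Exec P (initState (encode ε u)) σ t ∧
      t ≤ q.eval (inputSize (encode ε u)) ∧
      ∃ S : Fin m → Fin N, OutputsAllocation σ S ∧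
        SolvesMaxMin (toReal u) ((1 - ((ε : ℝ≥0) : ℝ≥0∞)) * target m (toReal u)) S

end GoodsMmS

end

/-! Part (a): let `S` solve the `lam`-max-min problem. Giving each active agent (`c i > 0`) at least
its bundle in `S` yields `u i (T i) / c i ≥ lam * MmS i / c i ≥ lam`, so the optimum of the
scheduling step is at least `lam`. A `β`-approximation then gives agent `i` at least `β * lam * c i
≥ α * β * lam * MmS i`, and `α * β > 1 - ε`. An agent with `c i = 0` has `MmS i = 0`, since `α > 0`.
This is `IsRun.solvesMaxMin`; both approximation claims are the cases `lam = optRatio u` and `lam =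
1`. Executions exist because exact shares and exact optimal schedules are allowed (`exists_isRun`).

Part (b): both steps are instances of one problem, maximizing the least load on a fixed number `N`
of machines. For the share of agent `r` all machines use the utilities of `r`; for the allocation
the machines are the active agents. With `K = 2 * ε.den`, a factor `(K - 1) / K` in each step is
enough, by `one_sub_lt_accuracy_sq`.

The subroutine tries all units `d = 2 ^ t` up to the load bound. Processing times are divided by
`d`, rounded down and capped at `C = 2 * m * K`, so that a vector of rounded loads is an `N`-digit
number in base `m * C + 1`. A dynamic program runs over these numbers, polynomially many for fixed
`N` and `K`, and keeps one exact schedule for each. For the least `d` with `V ≤ d * C`, where `V` is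
the least load of a given schedule, rounding loses at most `m * (d - 1) ≤ V / K` on each machine,
and a capped job alone already provides `d * C ≥ V`. Hence any schedule with the same rounded loads
is good enough (`exists_unit`), and the best one over all units meets the guarantee
(`reaches_maxMin`).

All arithmetic is exact: utilities are multiplied by the product of all denominators, relative
utilities by the product of the positive shares, and a whole schedule with its loads is one number.
For the running time, `Reaches` counts steps while every cell stays below `2 ^ B`; a step costs at
most a constant times `(B + 1) ^ 2`. Step count and `B` are polynomials in the input length once `N`
and `ε` are fixed (`isPoly_time`). -/

namespace GoodsMmS

open Finset

/-! ### Expressions: derived operations and size bounds -/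

namespace Expr

/-- Power with a fixed exponent. -/
def pow (e : Expr) : ℕ → Expr
  | 0 => .const 1
  | n + 1 => .mul (e.pow n) e

/-- Remainder of the division of `e` by `f`. -/
def mod (e f : Expr) : Expr := .sub e (.mul f (.div e f))

/-- The smaller of two values. -/
def min (e f : Expr) : Expr := .sub e (.sub e f)

/-- The value of `x` if `c` is not zero, and of `y` otherwise. -/
def ite (c x y : Expr) : Expr :=
  .add (.mul (.sub (.const 1) (.sub (.const 1) c)) x) (.mul (.sub (.const 1) c) y)

/-- Content of cell `0` of an array that is used as a variable. -/
def var (a : ℕ) : Expr := .read a (.const 0)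

@[simp] theorem eval_pow (σ : State) (e : Expr) (n : ℕ) : (e.pow n).eval σ = e.eval σ ^ n := by
  induction n with
  | zero => rfl
  | succ n ih => simp [pow, eval, ih, pow_succ]

@[simp] theorem eval_mod (σ : State) (e f : Expr) : (e.mod f).eval σ = e.eval σ % f.eval σ := by
  simp only [mod, eval]
  have := Nat.div_add_mod (e.eval σ) (f.eval σ)
  omega

@[simp] theorem eval_min (σ : State) (e f : Expr) :
    (e.min f).eval σ = Min.min (e.eval σ) (f.eval σ) := by
  simp only [min, eval]
  omega

@[simp] theorem eval_ite (σ : State) (c x y : Expr) :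
    (ite c x y).eval σ = if c.eval σ = 0 then y.eval σ else x.eval σ := by
  simp only [ite, eval]
  split_ifs with h
  · simp [h]
  · have h₁ : 1 - c.eval σ = 0 := by omega
    simp [h₁]

@[simp] theorem eval_var (σ : State) (a : ℕ) : (var a).eval σ = σ a 0 := rfl

/-- Bounds the bit length of the value, in units of the bit length of the cells. -/
def width : Expr → ℕ
  | .const n => bits n
  | .read _ e => e.width + 1
  | .add e f => e.width + f.width
  | .sub e f => e.width + f.width
  | .mul e f => e.width + f.width
  | .div e f => e.width + f.width

/-- Bounds the cost, in units of the squared bit length of the cells. -/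
def weight : Expr → ℕ
  | .const n => bits n
  | .read _ e => e.weight + e.width + 1
  | .add e f => e.weight + f.weight + e.width + f.width
  | .sub e f => e.weight + f.weight + e.width + f.width
  | .mul e f => e.weight + f.weight + e.width * f.width
  | .div e f => e.weight + f.weight + e.width * f.width

end Expr

theorem bits_mono {a b : ℕ} (h : a ≤ b) : bits a ≤ bits b :=
  Nat.add_le_add_right (Nat.size_le_size h) 1

/-- The extra one in `bits` absorbs the carry, so sums obey the same bound as products. -/
theorem bits_add_le (a b : ℕ) : bits (a + b) ≤ bits a + bits b := by
  have : Nat.size (a + b) ≤ Nat.size a + Nat.size b + 1 := by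
    rw [Nat.size_le, pow_succ]
    have ha := Nat.lt_size_self a
    have hb := Nat.lt_size_self b
    have h₁ : 2 ^ a.size ≤ 2 ^ (a.size + b.size) := Nat.pow_le_pow_right (by norm_num) (by omega)
    have h₂ : 2 ^ b.size ≤ 2 ^ (a.size + b.size) := Nat.pow_le_pow_right (by norm_num) (by omega)
    omega
  unfold bits
  omega

theorem bits_mul_le (a b : ℕ) : bits (a * b) ≤ bits a + bits b := by
  have : Nat.size (a * b) ≤ Nat.size a + Nat.size b := by
    rw [Nat.size_le, pow_add]
    exact Nat.mul_lt_mul'' (Nat.lt_size_self a) (Nat.lt_size_self b)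
  unfold bits
  omega

theorem bits_pos (a : ℕ) : 0 < bits a := Nat.succ_pos _

/-- All cells hold numbers of at most `B` bits. -/
def Bounded (B : ℕ) (σ : State) : Prop := ∀ a k, σ a k < 2 ^ B

theorem Bounded.bits_le {B : ℕ} {σ : State} (h : Bounded B σ) (a k : ℕ) :
    bits (σ a k) ≤ B + 1 :=
  Nat.add_le_add_right (Nat.size_le.2 (h a k)) 1

theorem Bounded.set {B : ℕ} {σ : State} (h : Bounded B σ) (a k : ℕ) {v : ℕ} (hv : v < 2 ^ B) :
    Bounded B (σ.set a k v) := by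
  intro b l
  rw [State.set, Function.update_apply]
  split_ifs with h₁
  · rw [Function.update_apply]
    split_ifs
    exacts [hv, h _ _]
  · exact h _ _

/-- Intermediate values may exceed `B` bits, but only by a factor fixed by the expression; a read
always returns to the size of a cell. -/
theorem Expr.bits_eval_le {B : ℕ} {σ : State} (h : Bounded B σ) (e : Expr) :
    bits (e.eval σ) ≤ e.width * (B + 1) := by
  induction e with
  | const n => exact Nat.le_mul_of_pos_right _ (by omega)
  | read a e ih =>
    refine (h.bits_le _ _).trans ?_
    exact Nat.le_mul_of_pos_left _ (Nat.succ_pos _)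
  | add e f he hf =>
    simp only [eval, width, add_mul]
    exact (bits_add_le _ _).trans (add_le_add he hf)
  | mul e f he hf =>
    simp only [eval, width, add_mul]
    exact (bits_mul_le _ _).trans (add_le_add he hf)
  | sub e f he hf =>
    simp only [eval, width, add_mul]
    exact ((bits_mono (Nat.sub_le _ _)).trans he).trans (Nat.le_add_right _ _)
  | div e f he hf =>
    simp only [eval, width, add_mul]
    exact ((bits_mono (Nat.div_le_self _ _)).trans he).trans (Nat.le_add_right _ _)

/-- Multiplication and division are charged the product of two bit lengths, whence the square. -/
theorem Expr.cost_le {B : ℕ} {σ : State} (h : Bounded B σ) (e : Expr) :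
    e.cost σ ≤ e.weight * (B + 1) ^ 2 := by
  have hB : B + 1 ≤ (B + 1) ^ 2 := Nat.le_self_pow (by norm_num) _
  have lin : ∀ e : Expr, bits (e.eval σ) ≤ e.width * (B + 1) ^ 2 := fun e =>
    (e.bits_eval_le h).trans (Nat.mul_le_mul_left _ hB)
  have quad : ∀ e f : Expr, bits (e.eval σ) * bits (f.eval σ) ≤
      e.width * f.width * (B + 1) ^ 2 := fun e f =>
    (Nat.mul_le_mul (e.bits_eval_le h) (f.bits_eval_le h)).trans (by
      rw [mul_mul_mul_comm, sq])
  induction e with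
  | const n => exact Nat.le_mul_of_pos_right _ (by positivity)
  | read a e ih =>
    have h₁ := lin e
    have h₂ := h.bits_le a (e.eval σ)
    simp only [cost, weight, add_mul]
    omega
  | add e f he hf =>
    have h₁ := lin e
    have h₂ := lin f
    simp only [cost, weight, add_mul]
    omega
  | sub e f he hf =>
    have h₁ := lin e
    have h₂ := lin f
    simp only [cost, weight, add_mul]
    omega
  | mul e f he hf =>
    have h₁ := quad e f
    simp only [cost, weight, add_mul]
    omega
  | div e f he hf =>
    have h₁ := quad e f
    simp only [cost, weight, add_mul]
    omega

/-! ### Reasoning about programs -/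

/-- Bounds the cost of one step of the program, in units of the squared bit length of the cells. -/
def Prog.weight : Prog → ℕ
  | .skip => 1
  | .write _ e f => e.weight + f.weight + e.width + f.width
  | .seq P Q => P.weight + Q.weight + 1
  | .cond e P Q => e.weight + P.weight + Q.weight + 1
  | .loop e P => e.weight + P.weight + 1

/-- Started in `σ`, the program `P` halts after at most `n` steps in a state with property `post`,
and all cells still hold numbers of at most `B` bits. -/
def Reaches (B : ℕ) (P : Prog) (σ : State) (n : ℕ) (post : State → Prop) : Prop :=
  ∃ τ t, Exec P σ τ t ∧ t ≤ n * P.weight * (B + 1) ^ 2 ∧ Bounded B τ ∧ post τ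

section Reaches

variable {B : ℕ} {P Q : Prog} {σ : State} {n k : ℕ} {post mid : State → Prop}

theorem Reaches.imp {post' : State → Prop} (h : Reaches B P σ n post)
    (himp : ∀ τ, Bounded B τ → post τ → post' τ) : Reaches B P σ n post' := by
  obtain ⟨τ, t, h₁, h₂, h₃, h₄⟩ := h
  exact ⟨τ, t, h₁, h₂, h₃, himp τ h₃ h₄⟩

theorem Reaches.mono (h : Reaches B P σ n post) (hn : n ≤ k) : Reaches B P σ k post := by
  obtain ⟨τ, t, h₁, h₂, h₃, h₄⟩ := h
  refine ⟨τ, t, h₁, h₂.trans ?_, h₃, h₄⟩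
  gcongr

theorem reaches_write (a : ℕ) (e f : Expr) (hσ : Bounded B σ) (hv : f.eval σ < 2 ^ B)
    (h : post (σ.set a (e.eval σ) (f.eval σ))) : Reaches B (.write a e f) σ 1 post := by
  refine ⟨_, _, .write a e f σ, ?_, hσ.set _ _ hv, h⟩
  have hB : B + 1 ≤ (B + 1) ^ 2 := Nat.le_self_pow (by norm_num) _
  have h₁ := e.cost_le hσ
  have h₂ := f.cost_le hσ
  have h₃ := (e.bits_eval_le hσ).trans (Nat.mul_le_mul_left _ hB)
  have h₄ := (f.bits_eval_le hσ).trans (Nat.mul_le_mul_left _ hB)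
  simp only [Prog.weight, one_mul, add_mul]
  omega

/-- Both halves are charged at the weight of the whole program, so only step counts need to be
added. -/
theorem Reaches.seq (h₁ : Reaches B P σ n mid)
    (h₂ : ∀ τ, Bounded B τ → mid τ → Reaches B Q τ k post) :
    Reaches B (.seq P Q) σ (n + k + 1) post := by
  obtain ⟨τ, s, e₁, c₁, b₁, m₁⟩ := h₁
  obtain ⟨ρ, t, e₂, c₂, b₂, m₂⟩ := h₂ τ b₁ m₁
  refine ⟨ρ, _, .seq e₁ e₂, ?_, b₂, m₂⟩
  have hB : 1 ≤ (B + 1) ^ 2 := Nat.one_le_pow _ _ (by omega)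
  have h₁ : n * P.weight * (B + 1) ^ 2 ≤ n * (P.weight + Q.weight + 1) * (B + 1) ^ 2 := by
    gcongr; omega
  have h₂ : k * Q.weight * (B + 1) ^ 2 ≤ k * (P.weight + Q.weight + 1) * (B + 1) ^ 2 := by
    gcongr; omega
  have h₃ : 1 ≤ (P.weight + Q.weight + 1) * (B + 1) ^ 2 :=
    hB.trans (Nat.le_mul_of_pos_left _ (by omega))
  simp only [Prog.weight, add_mul, one_mul] at *
  omega

/-- The invariant is indexed by the number of completed passes and has to determine whether the
guard vanishes; this fixes the number of passes. -/
theorem reaches_loop (e : Expr) (I : ℕ → State → Prop) (n c : ℕ)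
    (hstep : ∀ k < n, ∀ τ, Bounded B τ → I k τ →
      e.eval τ ≠ 0 ∧ Reaches B P τ c (I (k + 1)))
    (hexit : ∀ τ, I n τ → e.eval τ = 0) (hσ : Bounded B σ) (h0 : I 0 σ) :
    Reaches B (.loop e P) σ (n * (c + 1) + 1) (I n) := by
  have hB : 1 ≤ (B + 1) ^ 2 := Nat.one_le_pow _ _ (by omega)
  -- Induction on the number `l` of passes still to come, from an arbitrary state.
  have key : ∀ l k σ, k + l = n → Bounded B σ → I k σ →
      Reaches B (.loop e P) σ (l * (c + 1) + 1) (I n) := by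
    intro l
    induction l with
    | zero =>
      intro k σ hk hσ hI
      obtain rfl : k = n := by omega
      refine ⟨σ, _, .loopStop (hexit σ hI), ?_, hσ, hI⟩
      have := e.cost_le hσ
      simp only [Prog.weight, add_mul, zero_mul, one_mul]
      omega
    | succ l ih =>
      intro k σ hk hσ hI
      obtain ⟨he, τ, s, e₁, c₁, b₁, m₁⟩ := hstep k (by omega) σ hσ hI
      obtain ⟨ρ, t, e₂, c₂, b₂, m₂⟩ := ih (k + 1) τ (by omega) b₁ m₁
      refine ⟨ρ, _, .loopStep he e₁ e₂, ?_, b₂, m₂⟩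
      have h₁ := e.cost_le hσ
      have h₂ : c * P.weight * (B + 1) ^ 2 ≤ c * (e.weight + P.weight + 1) * (B + 1) ^ 2 := by
        gcongr; omega
      have h₃ : (e.weight + 1) * (B + 1) ^ 2 ≤ (e.weight + P.weight + 1) * (B + 1) ^ 2 := by
        gcongr; omega
      have h₄ : ((l + 1) * (c + 1) + 1) * (e.weight + P.weight + 1) * (B + 1) ^ 2 =
          (l * (c + 1) + 1) * (e.weight + P.weight + 1) * (B + 1) ^ 2 +
          c * (e.weight + P.weight + 1) * (B + 1) ^ 2 +
          (e.weight + P.weight + 1) * (B + 1) ^ 2 := by ring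
      simp only [Prog.weight] at *
      rw [h₄]
      have h₅ : (e.weight + 1) * (B + 1) ^ 2 = e.weight * (B + 1) ^ 2 + (B + 1) ^ 2 := by ring
      omega
  exact key n 0 σ (by omega) hσ h0

/-- Execute `P` while the variable `v` runs through the numbers below `e`. -/
def Prog.for (v : ℕ) (e : Expr) (P : Prog) : Prog :=
  .seq (.write v (.const 0) (.const 0))
    (.loop (.sub e (.var v)) (.seq P (.write v (.const 0) (.add (.var v) (.const 1)))))

@[simp] theorem State.set_same (σ : State) (a k v : ℕ) : σ.set a k v a k = v := by
  simp [State.set]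

theorem State.set_of_ne (σ : State) {a b : ℕ} (h : b ≠ a) (k v : ℕ) : σ.set a k v b = σ b := by
  simp [State.set, h]

theorem State.set_self (σ : State) (a k v l : ℕ) :
    σ.set a k v a l = if l = k then v else σ a l := by
  simp [State.set, Function.update]

/-- The invariant must not depend on the loop variable (`hI`), since the counter is updated only
after the body has established `I (k + 1)`. -/
theorem reaches_for (v : ℕ) (e : Expr) (I : ℕ → State → Prop) (n c : ℕ) (hn : n < 2 ^ B)
    (hI : ∀ k τ x, I k τ → I k (τ.set v 0 x)) (he : ∀ k τ, I k τ → e.eval τ = n)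
    (hstep : ∀ k < n, ∀ τ, Bounded B τ → I k τ → τ v 0 = k →
      Reaches B P τ c fun ρ => I (k + 1) ρ ∧ ρ v 0 = k)
    (hσ : Bounded B σ) (h0 : I 0 σ) :
    Reaches B (Prog.for v e P) σ (n * (c + 3) + 3) (I n) := by
  have h : Reaches B (Prog.for v e P) σ (1 + (n * (c + 1 + 1 + 1) + 1) + 1)
      fun τ => I n τ ∧ τ v 0 = n := by
    refine Reaches.seq (mid := fun τ => I 0 τ ∧ τ v 0 = 0)
      (reaches_write _ _ _ hσ (by simp [Expr.eval]) ?_) fun τ hτ hm => ?_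
    · exact ⟨hI _ _ _ h0, by simp [Expr.eval]⟩
    · refine reaches_loop _ (fun k τ => I k τ ∧ τ v 0 = k) n (c + 1 + 1) ?_ ?_ hτ hm
      · rintro k hk τ hτ ⟨h₁, h₂⟩
        refine ⟨?_, ?_⟩
        · simp only [Expr.eval, Expr.eval_var, he k τ h₁, h₂]
          omega
        · refine (hstep k hk τ hτ h₁ h₂).seq fun ρ hρ hm => ?_
          refine reaches_write _ _ _ hρ ?_ ?_
          · simp only [Expr.eval, Expr.eval_var, hm.2]
            omega
          · simp only [Expr.eval, Expr.eval_var, hm.2]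
            exact ⟨hI _ _ _ hm.1, by simp⟩
      · rintro τ ⟨h₁, h₂⟩
        simp [Expr.eval, he n τ h₁, h₂]
  refine (h.imp fun τ _ h => h.1).mono ?_
  have : c + 1 + 1 + 1 = c + 3 := by ring
  rw [this]
  omega

end Reaches

/-! ### Digits -/

theorem sum_digits_lt {X : ℕ} {s : ℕ → ℕ} {n : ℕ} (hs : ∀ i < n, s i < X) :
    ∑ i ∈ range n, s i * X ^ i < X ^ n := by
  induction n with
  | zero => simp
  | succ n ih =>
    rw [sum_range_succ, pow_succ]
    have h₁ := ih fun i hi => hs i (by omega)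
    have h₂ : (s n + 1) * X ^ n ≤ X * X ^ n := Nat.mul_le_mul_right _ (hs n (by omega))
    rw [add_mul, mul_comm X] at h₂
    omega

theorem sum_digits_div {X : ℕ} {s : ℕ → ℕ} {n : ℕ} (hs : ∀ i < n, s i < X) (t : ℕ) :
    (∑ i ∈ range n, s i * X ^ i + X ^ n * t) / X ^ n = t := by
  have h := sum_digits_lt hs
  rw [Nat.add_mul_div_left _ _ (by omega), Nat.div_eq_of_lt h, zero_add]

/-- The summand `X ^ n * t` leaves room above the digits; codes of schedules store the assignment
there. -/
theorem sum_digits_div_mod {X : ℕ} {s : ℕ → ℕ} {n : ℕ} (hs : ∀ i < n, s i < X) (t : ℕ) {k : ℕ}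
    (hk : k < n) : (∑ i ∈ range n, s i * X ^ i + X ^ n * t) / X ^ k % X = s k := by
  induction n generalizing t with
  | zero => omega
  | succ n ih =>
    have h : ∑ i ∈ range (n + 1), s i * X ^ i + X ^ (n + 1) * t =
        ∑ i ∈ range n, s i * X ^ i + X ^ n * (s n + X * t) := by
      rw [sum_range_succ]; ring
    have hs' : ∀ i < n, s i < X := fun i hi => hs i (by omega)
    rw [h]
    rcases Nat.lt_succ_iff_lt_or_eq.1 hk with hk | rfl
    · exact ih hs' _ hk
    · rw [sum_digits_div hs', Nat.add_mul_mod_self_left, Nat.mod_eq_of_lt (hs k (by omega))]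

/-! ### Loads of machines -/

/-- The load of machine `i` if the jobs below `m` are scheduled according to `S`. -/
def load (p : ℕ → ℕ → ℕ) (S : ℕ → ℕ) (m i : ℕ) : ℕ :=
  ∑ j ∈ range m, if S j = i then p i j else 0

/-- `S` assigns the jobs below `m` to machines `i < N` with `b i ≠ 0`. -/
def Feasible (N : ℕ) (b : ℕ → ℕ) (m : ℕ) (S : ℕ → ℕ) : Prop := ∀ j < m, S j < N ∧ b (S j) ≠ 0

theorem load_le (p : ℕ → ℕ → ℕ) (S : ℕ → ℕ) (m i : ℕ) : load p S m i ≤ ∑ j ∈ range m, p i j :=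
  sum_le_sum fun j _ => by split_ifs <;> omega

theorem load_mono (p : ℕ → ℕ → ℕ) (S : ℕ → ℕ) {k m : ℕ} (h : k ≤ m) (i : ℕ) :
    load p S k i ≤ load p S m i :=
  sum_le_sum_of_subset (range_subset_range.2 h)

/-- Each job contributes in the digit of its machine, so adding one number per job accumulates all
loads at once. This is an exchange of the two sums. -/
theorem sum_mul_pow_eq_sum_load {N m : ℕ} {b S : ℕ → ℕ} (hS : Feasible N b m S)
    (f : ℕ → ℕ → ℕ) (X : ℕ) :
    ∑ j ∈ range m, f (S j) j * X ^ S j = ∑ i ∈ range N, load f S m i * X ^ i := by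
  simp only [load, sum_mul]
  rw [sum_comm]
  refine sum_congr rfl fun j hj => ?_
  rw [sum_eq_single (S j)]
  · simp
  · intro i _ hi
    simp [hi.symm]
  · intro h
    exact absurd (mem_range.2 (hS j (mem_range.1 hj)).1) h

/-- The least load of the machines `i < n` with `b i ≠ 0`, for loads bounded by `P`. -/
def minLoad (P : ℕ) (b s : ℕ → ℕ) : ℕ → ℕ
  | 0 => P
  | n + 1 => if b n = 0 then minLoad P b s n else min (minLoad P b s n) (s n)

/-- The universal property of the minimum; the cap `P` gives it a value even if no machine is
active. -/
theorem le_minLoad_iff {P : ℕ} {b s : ℕ → ℕ} {n V : ℕ} :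
    V ≤ minLoad P b s n ↔ V ≤ P ∧ ∀ i < n, b i ≠ 0 → V ≤ s i := by
  induction n with
  | zero => simp [minLoad]
  | succ n ih =>
    rw [minLoad]
    split_ifs with h
    · rw [ih]
      refine and_congr_right fun _ => ⟨fun H i hi hb => ?_, fun H i hi => H i (by omega)⟩
      rcases Nat.lt_succ_iff_lt_or_eq.1 hi with hi | rfl
      exacts [H i hi hb, absurd h hb]
    · rw [le_min_iff, ih]
      refine ⟨fun H => ⟨H.1.1, fun i hi hb => ?_⟩, fun H =>
        ⟨⟨H.1, fun i hi => H.2 i (by omega)⟩, H.2 n (by omega) h⟩⟩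
      rcases Nat.lt_succ_iff_lt_or_eq.1 hi with hi | rfl
      exacts [H.1.2 i hi hb, H.2]

theorem minLoad_congr {P : ℕ} {b s s' : ℕ → ℕ} {n : ℕ} (h : ∀ i < n, s i = s' i) :
    minLoad P b s n = minLoad P b s' n := by
  induction n with
  | zero => rfl
  | succ n ih => rw [minLoad, minLoad, ih fun i hi => h i (by omega), h n (by omega)]

/-! ### The table of the dynamic program -/

/-- The largest `i < n` that leads to cell `y` of the next layer determines its content. -/
def tableStep (w g b : ℕ → ℕ) (prev : ℕ → ℕ) (y : ℕ) : ℕ → ℕ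
  | 0 => 0
  | n + 1 => if b n * (y + 1 - w n) * prev (y - w n) = 0 then tableStep w g b prev y n
      else prev (y - w n) + g n

/-- Layer `j` of the table: cell `y` holds `1 + ∑ g` for some schedule of the jobs below `j` with
`∑ w = y`, and `0` if there is none. -/
def table (N : ℕ) (w g : ℕ → ℕ → ℕ) (b : ℕ → ℕ) : ℕ → ℕ → ℕ
  | 0, y => 1 - y
  | j + 1, y => tableStep (fun i => w i j) (fun i => g i j) b (table N w g b j) y N

/-- The product tested in `tableStep` is a conjunction: machine active, weight at most `y` (by
truncation, `y + 1 - w i` is then nonzero), source cell occupied. -/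
theorem tableStep_eq {w g b prev : ℕ → ℕ} {y n : ℕ} (h : tableStep w g b prev y n ≠ 0) :
    ∃ i < n, b i ≠ 0 ∧ w i ≤ y ∧ prev (y - w i) ≠ 0 ∧
      tableStep w g b prev y n = prev (y - w i) + g i := by
  induction n with
  | zero => exact absurd rfl h
  | succ n ih =>
    rw [tableStep] at h ⊢
    split_ifs at h ⊢ with hc
    · obtain ⟨i, hi, H⟩ := ih h
      exact ⟨i, by omega, H⟩
    · simp only [mul_eq_zero, not_or] at hc
      exact ⟨n, by omega, hc.1.1, by omega, hc.2, rfl⟩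

theorem tableStep_ne_zero {w g b prev : ℕ → ℕ} {y n i : ℕ} (hi : i < n) (hb : b i ≠ 0)
    (hw : w i ≤ y) (hp : prev (y - w i) ≠ 0) : tableStep w g b prev y n ≠ 0 := by
  induction n with
  | zero => omega
  | succ n ih =>
    rw [tableStep]
    split_ifs with hc
    · rcases Nat.lt_succ_iff_lt_or_eq.1 hi with hi | rfl
      · exact ih hi
      · exfalso
        simp only [mul_eq_zero, hb, hp, false_or, or_false] at hc
        omega
    · simp only [mul_eq_zero, not_or] at hc
      omega

section Table

variable {N : ℕ} {w g : ℕ → ℕ → ℕ} {b : ℕ → ℕ}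

/-- Soundness of the dynamic program: the schedule behind the source cell is extended by the new
job. -/
theorem table_eq {j y : ℕ} (h : table N w g b j y ≠ 0) :
    ∃ S, Feasible N b j S ∧ ∑ k ∈ range j, w (S k) k = y ∧
      table N w g b j y = 1 + ∑ k ∈ range j, g (S k) k := by
  induction j generalizing y with
  | zero =>
    rw [table] at h ⊢
    exact ⟨id, fun j hj => by omega, by simp; omega, by simp; omega⟩
  | succ j ih =>
    obtain ⟨i, hi, hb, hw, hp, he⟩ := tableStep_eq h
    obtain ⟨S, hS, h₁, h₂⟩ := ih hp
    have hc : ∀ f : ℕ → ℕ → ℕ, ∑ k ∈ range j, f (Function.update S j i k) k =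
        ∑ k ∈ range j, f (S k) k := fun f => sum_congr rfl fun k hk => by
      rw [Function.update_of_ne (mem_range.1 hk).ne]
    refine ⟨Function.update S j i, fun k hk => ?_, ?_, ?_⟩
    · rcases Nat.lt_succ_iff_lt_or_eq.1 hk with hk | rfl
      · rw [Function.update_of_ne hk.ne]; exact hS k hk
      · rw [Function.update_self]; exact ⟨hi, hb⟩
    · rw [sum_range_succ, hc w, h₁, Function.update_self]
      omega
    · rw [table, he, sum_range_succ, hc g, h₂, Function.update_self]
      ring

/-- Completeness: only one schedule survives per sum of weights, but no attainable sum is lost. -/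
theorem table_ne_zero {j : ℕ} {S : ℕ → ℕ} (hS : Feasible N b j S) :
    table N w g b j (∑ k ∈ range j, w (S k) k) ≠ 0 := by
  induction j with
  | zero => simp [table]
  | succ j ih =>
    rw [sum_range_succ, table]
    refine tableStep_ne_zero (hS j (by omega)).1 (hS j (by omega)).2 (by omega) ?_
    rw [Nat.add_sub_cancel]
    exact ih fun k hk => hS k (by omega)

end Table

/-! ### Schedules as numbers -/

/-- Contribution of the assignment of job `j` to machine `i` to the code of a schedule. -/
def codeTerm (N P : ℕ) (p : ℕ → ℕ → ℕ) (i j : ℕ) : ℕ :=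
  p i j * (P + 1) ^ i + i * N ^ j * (P + 1) ^ N

/-- The code of a schedule; its digits are the loads of the machines and the schedule. -/
def code (N P : ℕ) (p : ℕ → ℕ → ℕ) (m : ℕ) (S : ℕ → ℕ) : ℕ :=
  1 + ∑ j ∈ range m, codeTerm N P p (S j) j

/-- The least load of the schedule with code `e`. -/
def codeMin (N P : ℕ) (b : ℕ → ℕ) (e : ℕ) : ℕ :=
  minLoad P b (fun i => (e - 1) / (P + 1) ^ i % (P + 1)) N

/-- The machine of job `j` in the schedule with code `e`. -/
def codeMachine (N P e j : ℕ) : ℕ := (e - 1) / (P + 1) ^ N / N ^ j % N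

section Code

variable {N P m : ℕ} {p : ℕ → ℕ → ℕ} {b S : ℕ → ℕ}

/-- The low digits, in base `P + 1`, are the loads; above them stands the assignment in base `N`.
The code carries an additional one so that zero can mark an empty cell. -/
theorem code_sub_one (hS : Feasible N b m S) : code N P p m S - 1 =
    ∑ i ∈ range N, load p S m i * (P + 1) ^ i + (P + 1) ^ N * ∑ j ∈ range m, S j * N ^ j := by
  rw [code, Nat.add_sub_cancel_left, ← sum_mul_pow_eq_sum_load hS, mul_sum, ← sum_add_distrib]
  exact sum_congr rfl fun j _ => by rw [codeTerm, mul_comm ((P + 1) ^ N)]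

theorem load_lt (hP : ∀ i < N, ∑ j ∈ range m, p i j ≤ P) {k : ℕ} (hk : k ≤ m) {i : ℕ}
    (hi : i < N) : load p S k i < P + 1 :=
  Nat.lt_succ_of_le (((load_mono p S hk i).trans (load_le p S m i)).trans (hP i hi))

theorem codeMin_code (hP : ∀ i < N, ∑ j ∈ range m, p i j ≤ P) (hS : Feasible N b m S) :
    codeMin N P b (code N P p m S) = minLoad P b (load p S m) N :=
  minLoad_congr fun i hi => by
    rw [code_sub_one hS, sum_digits_div_mod (fun i hi => load_lt hP le_rfl hi) _ hi]

theorem codeMachine_code (hP : ∀ i < N, ∑ j ∈ range m, p i j ≤ P) (hS : Feasible N b m S)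
    {j : ℕ} (hj : j < m) : codeMachine N P (code N P p m S) j = S j := by
  rw [codeMachine, code_sub_one hS, sum_digits_div fun i hi => load_lt hP le_rfl hi]
  simpa using sum_digits_div_mod (fun i hi => (hS i hi).1) 0 hj

/-- Strict bounds on both digit blocks leave room for the additional one. -/
theorem code_le (hP : ∀ i < N, ∑ j ∈ range m, p i j ≤ P) {k : ℕ} (hk : k ≤ m)
    (hS : Feasible N b k S) : code N P p k S ≤ (P + 1) ^ N * N ^ k := by
  have h₁ := code_sub_one (P := P) (p := p) hS
  have h₂ := sum_digits_lt (s := load p S k) fun i hi => load_lt hP hk hi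
  have h₃ := sum_digits_lt fun i hi => (hS i hi).1
  have h₄ : (P + 1) ^ N * (∑ j ∈ range k, S j * N ^ j + 1) ≤ (P + 1) ^ N * N ^ k :=
    Nat.mul_le_mul_left _ h₃
  rw [mul_add] at h₄
  omega

end Code

/-! ### Rounding -/

/-- Processing times in units of `d`, rounded down and capped at `C`, in the digit of their
machine. -/
def rounded (C m d : ℕ) (p : ℕ → ℕ → ℕ) (i j : ℕ) : ℕ := min (p i j / d) C * (m * C + 1) ^ i

section Rounding

variable {N P m C K d : ℕ} {p : ℕ → ℕ → ℕ} {b S T : ℕ → ℕ}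

theorem load_capped_lt (i : ℕ) :
    load (fun i j => min (p i j / d) C) S m i < m * C + 1 := by
  refine Nat.lt_succ_of_le ((load_le _ S m i).trans ?_)
  refine (sum_le_card_nsmul _ _ C fun j _ => min_le_right _ _).trans ?_
  simp

theorem sum_rounded_lt (hS : Feasible N b m S) :
    ∑ j ∈ range m, rounded C m d p (S j) j < (m * C + 1) ^ N := by
  simp only [rounded]
  rw [sum_mul_pow_eq_sum_load hS (fun i j => min (p i j / d) C)]
  exact sum_digits_lt fun i _ => load_capped_lt i

/-- Rounded loads stay below the base `m * C + 1`, so there are no carries and the sum determines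
every load. -/
theorem load_capped_eq (hS : Feasible N b m S) (hT : Feasible N b m T)
    (h : ∑ j ∈ range m, rounded C m d p (S j) j = ∑ j ∈ range m, rounded C m d p (T j) j)
    {i : ℕ} (hi : i < N) :
    load (fun i j => min (p i j / d) C) S m i = load (fun i j => min (p i j / d) C) T m i := by
  simp only [rounded] at h
  rw [sum_mul_pow_eq_sum_load hS (fun i j => min (p i j / d) C),
    sum_mul_pow_eq_sum_load hT (fun i j => min (p i j / d) C)] at h
  have h₁ := sum_digits_div_mod (fun i _ => load_capped_lt (p := p) (S := S) (m := m) (d := d)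
    (C := C) i) 0 hi
  have h₂ := sum_digits_div_mod (fun i _ => load_capped_lt (p := p) (S := T) (m := m) (d := d)
    (C := C) i) 0 hi
  rw [← h₁, ← h₂, h]

theorem mul_load_capped_le (i : ℕ) :
    d * load (fun i j => min (p i j / d) C) S m i ≤ load p S m i := by
  rw [load, load, mul_sum]
  refine sum_le_sum fun j _ => ?_
  split_ifs
  · exact (Nat.mul_le_mul_left _ (min_le_left _ _)).trans (Nat.mul_div_le _ _)
  · simp

/-- If some job on machine `i` reaches the cap, it alone supplies `d * C ≥ V`. Otherwise nothing is
cut off, and rounding loses at most `d - 1` per job. -/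
theorem le_mul_load_capped (hd : 0 < d) (i : ℕ) {V : ℕ} (hV : V ≤ load p T m i)
    (hC : V ≤ d * C) :
    V ≤ d * load (fun i j => min (p i j / d) C) T m i + m * (d - 1) := by
  by_cases h : ∃ j ∈ range m, T j = i ∧ C ≤ p i j / d
  · obtain ⟨j, hj, hT, hp⟩ := h
    have h₁ : C ≤ load (fun i j => min (p i j / d) C) T m i := by
      have := single_le_sum (f := fun j => if T j = i then min (p i j / d) C else 0)
        (fun _ _ => Nat.zero_le _) hj
      simp only [hT, if_true, min_eq_right hp] at this
      exact this
    have := Nat.mul_le_mul_left d h₁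
    omega
  · push Not at h
    refine hV.trans ?_
    have h₁ : m * (d - 1) = ∑ j ∈ range m, (d - 1) := by simp
    rw [load, load, mul_sum, h₁, ← sum_add_distrib]
    refine sum_le_sum fun j hj => ?_
    split_ifs with hT
    · rw [min_eq_left (h j hj hT).le]
      have := Nat.div_add_mod (p i j) d
      have := Nat.mod_lt (p i j) hd
      omega
    · simp

/-- For a suitable unit, schedules with the same rounded loads are almost equally good. -/
theorem exists_unit (hT : Feasible N b m T) (hK : 0 < K) (P : ℕ) :
    ∃ t < Nat.size (P + 1), ∀ S, Feasible N b m S →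
      ∑ j ∈ range m, rounded (2 * m * K) m (2 ^ t) p (S j) j =
        ∑ j ∈ range m, rounded (2 * m * K) m (2 ^ t) p (T j) j →
      (K - 1) * minLoad P b (load p T m) N ≤ K * minLoad P b (load p S m) N := by
  set V := minLoad P b (load p T m) N with hV
  obtain ⟨hVP, hVT⟩ := le_minLoad_iff.1 hV.le
  have hK1 : (K - 1) * V ≤ K * V := Nat.mul_le_mul_right _ (Nat.sub_le _ _)
  -- it suffices to bound the loads of the active machines
  have reduce : ∀ S, (∀ i < N, b i ≠ 0 → (K - 1) * V ≤ K * load p S m i) →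
      (K - 1) * V ≤ K * minLoad P b (load p S m) N := by
    intro S h
    -- This quotient is `(K - 1) * V / K` rounded up, the least `x` with `(K - 1) * V ≤ K * x`;
    -- `le_minLoad_iff` needs such a single natural number.
    have : ((K - 1) * V + (K - 1)) / K ≤ minLoad P b (load p S m) N := by
      rw [le_minLoad_iff]
      have aux : ∀ x, (K - 1) * V ≤ K * x → ((K - 1) * V + (K - 1)) / K ≤ x := fun x hx => by
        rw [Nat.div_le_iff_le_mul_add_pred hK]
        omega
      exact ⟨aux _ (hK1.trans (Nat.mul_le_mul_left _ hVP)), fun i hi hb => aux _ (h i hi hb)⟩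
    rw [Nat.div_le_iff_le_mul_add_pred hK] at this
    omega
  rcases Nat.eq_zero_or_pos m with rfl | hm
  -- Without jobs the cap vanishes, so there may be no suitable unit; but then `V` is zero as soon
  -- as one machine is active.
  · refine ⟨0, by rw [Nat.lt_size]; simp, fun S _ _ => reduce S fun i hi hb => ?_⟩
    have := hVT i hi hb
    simp only [load, range_zero, sum_empty] at this
    simp [Nat.le_zero.1 this]
  have hex : ∃ t, V ≤ 2 ^ t * (2 * m * K) :=
    ⟨V, Nat.lt_two_pow_self.le.trans (Nat.le_mul_of_pos_right _ (by positivity))⟩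
  classical
  obtain ⟨ht, hmin⟩ := (Nat.find_eq_iff hex).1 rfl
  set t := Nat.find hex
  -- the rounding errors sum up to at most `V / K`
  have herr : K * (m * (2 ^ t - 1)) ≤ V ∧ 2 ^ t ≤ P + 1 := by
    rcases Nat.eq_zero_or_pos t with h | h
    · simp [h]
    · have h₁ := hmin (t - 1) (by omega)
      have h₂ : 2 ^ t = 2 ^ (t - 1) * 2 := by rw [← pow_succ]; congr 1; omega
      have h₃ : 2 ^ (t - 1) * (2 * m * K) = K * (m * 2 ^ t) := by rw [h₂]; ring
      have h₄ : K * (m * (2 ^ t - 1)) ≤ K * (m * 2 ^ t) := by gcongr; omega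
      have h₅ : 2 ^ t ≤ K * (m * 2 ^ t) := by
        rw [← mul_assoc]; exact Nat.le_mul_of_pos_left _ (by positivity)
      omega
  refine ⟨t, by rw [Nat.lt_size]; exact herr.2, fun S hS h => reduce S fun i hi hb => ?_⟩
  have h₁ := le_mul_load_capped (by positivity) i (hVT i hi hb) ht
  rw [← load_capped_eq hS hT h hi] at h₁
  have h₂ := h₁.trans (Nat.add_le_add_right (mul_load_capped_le i) _)
  have h₃ := Nat.mul_le_mul_left K h₂
  rw [mul_add] at h₃
  rw [Nat.sub_mul, one_mul]
  omega

end Rounding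

/-! ### The max-min subroutine -/

namespace Expr

/-- The number of items. -/
def items : Expr := .read 0 (.const 2)

/-- The inverse of the accuracy of the max-min subroutine. -/
def accuracy : Expr := .mul (.const 2) (.read 0 (.const 1))

/-- Cap for rounded processing times. -/
def cap : Expr := .mul (.mul (.const 2) items) accuracy

/-- Base for rounded loads. -/
def loadBase : Expr := .add (.mul items cap) (.const 1)

/-- Number of cells in a layer of the table. -/
def layerSize (N : ℕ) : Expr := loadBase.pow N

/-- The item that belongs to the current cell. -/
def item (N : ℕ) : Expr := .sub (.div (var 8) (layerSize N)) (.const 1)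

/-- The position of the current cell in its layer. -/
def position (N : ℕ) : Expr := (var 8).mod (layerSize N)

/-- Rounded processing time of the current item. -/
def roundedE (N : ℕ) (p : ℕ → Expr → Expr) (i : ℕ) : Expr :=
  .mul ((Expr.div (p i (item N)) (var 10)).min cap) (loadBase.pow i)

/-- Code of the assignment of the current item. -/
def codeTermE (N : ℕ) (p : ℕ → Expr → Expr) (P : Expr) (i : ℕ) : Expr :=
  .add (.mul (p i (item N)) ((P.add (.const 1)).pow i))
    (.mul (.mul (.const i) (.read 5 (item N))) ((P.add (.const 1)).pow N))

/-- The cell of the previous layer from which assigning the current item to `i` leads to the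
current cell. -/
def source (N : ℕ) (p : ℕ → Expr → Expr) (i : ℕ) : Expr :=
  .read 7 (.sub (.sub (var 8) (layerSize N)) (roundedE N p i))

/-- Content of the current cell, from the previous layer. -/
def tableStepE (N : ℕ) (p : ℕ → Expr → Expr) (b : ℕ → Expr) (P : Expr) : ℕ → Expr
  | 0 => .const 0
  | n + 1 =>
    .ite (.mul (.mul (b n) (.sub (.add (position N) (.const 1)) (roundedE N p n))) (source N p n))
      (.add (source N p n) (codeTermE N p P n)) (tableStepE N p b P n)

/-- Content of the current cell. -/
def tableE (N : ℕ) (p : ℕ → Expr → Expr) (b : ℕ → Expr) (P : Expr) : Expr :=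
  .ite (.sub (layerSize N) (var 8)) (.sub (.const 1) (var 8)) (tableStepE N p b P N)

/-- Least load. -/
def minLoadE (P : Expr) (b s : ℕ → Expr) : ℕ → Expr
  | 0 => P
  | n + 1 => .ite (b n) ((minLoadE P b s n).min (s n)) (minLoadE P b s n)

/-- Least load of the schedule with a given code. -/
def codeMinE (N : ℕ) (b : ℕ → Expr) (P e : Expr) : Expr :=
  minLoadE P b (fun i => (Expr.div (.sub e (.const 1)) ((P.add (.const 1)).pow i)).mod
    (P.add (.const 1))) N

/-- A cell of the last layer of the table. -/
def candidate (N : ℕ) : Expr := .read 7 (.add (.mul items (layerSize N)) (var 9))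

/-- The better one of the best schedule so far and the candidate. -/
def betterE (N : ℕ) (b : ℕ → Expr) (P : Expr) : Expr :=
  .ite (.mul (candidate N) (.sub (.add (codeMinE N b P (candidate N)) (.const 1))
    (codeMinE N b P (var 11)))) (candidate N) (var 11)

theorem eval_minLoadE {P : Expr} {b s : ℕ → Expr} {τ : State} (n : ℕ) :
    (minLoadE P b s n).eval τ =
      minLoad (P.eval τ) (fun i => (b i).eval τ) (fun i => (s i).eval τ) n := by
  induction n with
  | zero => rfl
  | succ n ih => simp only [minLoadE, eval_ite, eval_min, ih, minLoad]

theorem eval_codeMinE (N : ℕ) (b : ℕ → Expr) (P e : Expr) (τ : State) :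
    (codeMinE N b P e).eval τ =
      codeMin N (P.eval τ) (fun i => (b i).eval τ) (e.eval τ) := by
  simp only [codeMinE, eval_minLoadE, codeMin, eval_mod, eval, eval_pow]

end Expr

/-- One pass of the max-min subroutine: fill the table for the current unit, look for better
schedules in its last layer, and double the unit. -/
def Prog.maxMinPass (N : ℕ) (p : ℕ → Expr → Expr) (b : ℕ → Expr) (P : Expr) : Prog :=
  .seq (.for 8 (.mul (.add .items (.const 1)) (.layerSize N))
      (.write 7 (.var 8) (.tableE N p b P)))
    (.seq (.for 9 (.layerSize N) (.write 11 (.const 0) (.betterE N b P)))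
      (.write 10 (.const 0) (.mul (.const 2) (.var 10))))

/-- The max-min subroutine: `p i j` is the processing time of job `j` on machine `i`, the machines
with `b i ≠ 0` are to be used, and `P` bounds the loads. -/
def Prog.maxMin (N : ℕ) (p : ℕ → Expr → Expr) (b : ℕ → Expr) (P : Expr) : Prog :=
  .seq (.write 11 (.const 0) (.const 0)) (.seq (.write 10 (.const 0) (.const 1))
    (.loop (.sub (.add P (.const 2)) (.var 10)) (.maxMinPass N p b P)))

/-- The states agree outside the working memory of the max-min subroutine. -/
def Agree (σ τ : State) : Prop := ∀ a < 7, τ a = σ a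

theorem Agree.set {σ τ : State} (h : Agree σ τ) {a : ℕ} (ha : 7 ≤ a) (k v : ℕ) :
    Agree σ (τ.set a k v) := fun b hb => by
  rw [State.set_of_ne _ (by omega), h b hb]

/-- In states that agree with `σ`, the expressions have the given values. -/
structure MaxMinInput (N m K : ℕ) (p : ℕ → Expr → Expr) (b : ℕ → Expr) (P : Expr)
    (pv : ℕ → ℕ → ℕ) (bv : ℕ → ℕ) (Pv : ℕ) (σ : State) : Prop where
  items : σ 0 2 = m
  accuracy : 2 * σ 0 1 = K
  powers : ∀ j < m, σ 5 j = N ^ j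
  time : ∀ τ, Agree σ τ → ∀ i e, (p i e).eval τ = pv i (e.eval τ)
  mask : ∀ τ, Agree σ τ → ∀ i, (b i).eval τ = bv i
  bound : ∀ τ, Agree σ τ → P.eval τ = Pv
  sum_le : ∀ i < N, ∑ j ∈ range m, pv i j ≤ Pv

namespace MaxMinInput

variable {N m K : ℕ} {p : ℕ → Expr → Expr} {b : ℕ → Expr} {P : Expr}
  {pv : ℕ → ℕ → ℕ} {bv : ℕ → ℕ} {Pv : ℕ} {σ τ : State}

/-- The size of a layer of the table. -/
def layer (N m K : ℕ) : ℕ := (m * (2 * m * K) + 1) ^ N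

theorem layer_pos (N m K : ℕ) : 0 < layer N m K := by unfold layer; positivity

/-- The table of the dynamic program for the unit `d`. -/
def cell (N m K : ℕ) (pv : ℕ → ℕ → ℕ) (bv : ℕ → ℕ) (Pv d j y : ℕ) : ℕ :=
  table N (rounded (2 * m * K) m d pv) (codeTerm N Pv pv) bv j y

theorem eval_items (h : MaxMinInput N m K p b P pv bv Pv σ) (hτ : Agree σ τ) :
    Expr.items.eval τ = m := by
  simp [Expr.items, Expr.eval, hτ 0 (by norm_num), h.items]

theorem eval_cap (h : MaxMinInput N m K p b P pv bv Pv σ) (hτ : Agree σ τ) :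
    Expr.cap.eval τ = 2 * m * K := by
  simp [Expr.cap, Expr.accuracy, Expr.eval, h.eval_items hτ, hτ 0 (by norm_num), ← h.accuracy]

theorem eval_loadBase (h : MaxMinInput N m K p b P pv bv Pv σ) (hτ : Agree σ τ) :
    Expr.loadBase.eval τ = m * (2 * m * K) + 1 := by
  simp [Expr.loadBase, Expr.eval, h.eval_items hτ, h.eval_cap hτ]

theorem eval_layerSize (h : MaxMinInput N m K p b P pv bv Pv σ) (hτ : Agree σ τ) :
    (Expr.layerSize N).eval τ = layer N m K := by
  simp [Expr.layerSize, h.eval_loadBase hτ, layer]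

/-- The layers lie one after the other: cell `z` has layer `z / R` and position `z % R`, with `R`
the layer size. Sources lie in the previous layer, so correctness of the earlier cells suffices. -/
theorem eval_tableE (h : MaxMinInput N m K p b P pv bv Pv σ) (hτ : Agree σ τ) {d z : ℕ}
    (hd : τ 10 0 = d) (hz : τ 8 0 = z) (hzm : z < (m + 1) * layer N m K)
    (ht : ∀ z' < z, τ 7 z' =
      cell N m K pv bv Pv d (z' / layer N m K) (z' % layer N m K)) :
    (Expr.tableE N p b P).eval τ =
      cell N m K pv bv Pv d (z / layer N m K) (z % layer N m K) := by
  set R := layer N m K with hR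
  have hR0 : 0 < R := layer_pos N m K
  simp only [Expr.tableE, Expr.eval_ite, Expr.eval, h.eval_layerSize hτ, Expr.eval_var, hz, ← hR]
  split_ifs with hzR
  · obtain ⟨j, hj⟩ : ∃ j, z / R = j + 1 :=
      Nat.exists_eq_succ_of_ne_zero (Nat.div_pos (by omega) hR0).ne'
    have hzj := Nat.div_add_mod z R
    have hy := Nat.mod_lt z hR0
    set y := z % R
    have hjm : j < m := by
      have : z / R < m + 1 := Nat.div_lt_of_lt_mul (by rwa [mul_comm])
      omega
    have hitem : (Expr.item N).eval τ = j := by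
      simp [Expr.item, Expr.eval, h.eval_layerSize hτ, hz, ← hR, hj]
    have hpos : (Expr.position N).eval τ = y := by
      simp [Expr.position, h.eval_layerSize hτ, hz, ← hR, y]
    have hround : ∀ i, (Expr.roundedE N p i).eval τ = rounded (2 * m * K) m d pv i j := fun i => by
      simp [Expr.roundedE, Expr.eval, h.time τ hτ, hitem, hd, h.eval_cap hτ,
        h.eval_loadBase hτ, rounded]
    have hcode : ∀ i, (Expr.codeTermE N p P i).eval τ = codeTerm N Pv pv i j := fun i => by
      simp [Expr.codeTermE, Expr.eval, h.time τ hτ, hitem, h.bound τ hτ, hτ 5 (by norm_num),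
        h.powers j hjm, codeTerm]
    have hsource : ∀ i, rounded (2 * m * K) m d pv i j ≤ y → (Expr.source N p i).eval τ =
        cell N m K pv bv Pv d j (y - rounded (2 * m * K) m d pv i j) := fun i hi => by
      have h₁ : z - R - rounded (2 * m * K) m d pv i j =
          y - rounded (2 * m * K) m d pv i j + R * j := by
        rw [hj, mul_add] at hzj
        omega
      simp only [Expr.source, Expr.eval, Expr.eval_var, hz, h.eval_layerSize hτ, hround, ← hR]
      rw [ht _ (by omega), h₁, Nat.add_mul_div_left _ _ hR0, Nat.add_mul_mod_self_left,
        Nat.div_eq_of_lt (by omega), Nat.mod_eq_of_lt (by omega), zero_add]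
    have hstep : ∀ n, (Expr.tableStepE N p b P n).eval τ =
        tableStep (fun i => rounded (2 * m * K) m d pv i j) (fun i => codeTerm N Pv pv i j) bv
          (cell N m K pv bv Pv d j) y n := by
      intro n
      induction n with
      | zero => rfl
      | succ n ih =>
        simp only [Expr.tableStepE, Expr.eval_ite, Expr.eval, h.mask τ hτ, hpos, hround, hcode, ih,
          tableStep]
        -- If the weight exceeds the position, the address read is not in the intended place, but
        -- the factor `y + 1 - w` is zero and discards the value.
        by_cases hw : rounded (2 * m * K) m d pv n j ≤ y
        · rw [hsource n hw]
        · have : y + 1 - rounded (2 * m * K) m d pv n j = 0 := by omega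
          simp [this]
    rw [hj, hstep]
    rfl
  · have h₁ : z < R := by omega
    rw [Nat.div_eq_of_lt h₁, Nat.mod_eq_of_lt h₁]
    rfl

/-- `e` is zero or the code of a feasible schedule. -/
def IsCode (N m : ℕ) (pv : ℕ → ℕ → ℕ) (bv : ℕ → ℕ) (Pv e : ℕ) : Prop :=
  e = 0 ∨ ∃ S, Feasible N bv m S ∧ e = code N Pv pv m S

/-- `e` is at least as good as all schedules in the first `k` cells of the last layer of the table
for the unit `d`. -/
def Beats (N m K : ℕ) (pv : ℕ → ℕ → ℕ) (bv : ℕ → ℕ) (Pv d k e : ℕ) : Prop :=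
  ∀ y < k, cell N m K pv bv Pv d m y ≠ 0 →
    e ≠ 0 ∧ codeMin N Pv bv (cell N m K pv bv Pv d m y) ≤ codeMin N Pv bv e

theorem cell_isCode (d j y : ℕ) : IsCode N j pv bv Pv (cell N m K pv bv Pv d j y) := by
  by_cases h : cell N m K pv bv Pv d j y = 0
  · exact .inl h
  · obtain ⟨S, hS, -, h⟩ := table_eq h
    exact .inr ⟨S, hS, h⟩

/-- One size bound for all layers, so that every table entry fits into a cell. -/
theorem isCode_le (hN : 0 < N) (h : MaxMinInput N m K p b P pv bv Pv σ) {j e : ℕ} (hj : j ≤ m)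
    (he : IsCode N j pv bv Pv e) : e ≤ (Pv + 1) ^ N * N ^ m := by
  rcases he with rfl | ⟨S, hS, rfl⟩
  · exact Nat.zero_le _
  · refine (code_le h.sum_le hj hS).trans ?_
    gcongr

/-- The better one of two codes. -/
def better (N : ℕ) (bv : ℕ → ℕ) (Pv e f : ℕ) : ℕ :=
  if f * (codeMin N Pv bv f + 1 - codeMin N Pv bv e) = 0 then e else f

theorem eval_betterE (h : MaxMinInput N m K p b P pv bv Pv σ) (hτ : Agree σ τ) {d y : ℕ}
    (hy : τ 9 0 = y) (hym : y < layer N m K)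
    (ht : ∀ y < layer N m K, τ 7 (m * layer N m K + y) = cell N m K pv bv Pv d m y) :
    (Expr.betterE N b P).eval τ = better N bv Pv (τ 11 0) (cell N m K pv bv Pv d m y) := by
  have hc : (Expr.candidate N).eval τ = cell N m K pv bv Pv d m y := by
    simp [Expr.candidate, Expr.eval, h.eval_items hτ, h.eval_layerSize hτ, hy, ht y hym]
  have hb : (fun i => (b i).eval τ) = bv := funext (h.mask τ hτ)
  simp only [Expr.betterE, Expr.eval_ite, Expr.eval, hc, Expr.eval_codeMinE, h.bound τ hτ, hb,
    Expr.eval_var, better]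

theorem better_eq_or (e f : ℕ) : better N bv Pv e f = e ∨ better N bv Pv e f = f := by
  unfold better
  split_ifs <;> simp

/-- By truncated subtraction, zero decodes to loads that are all zero; the initial value thus loses
against, or ties with, every code. -/
theorem codeMin_zero_le (f : ℕ) : codeMin N Pv bv 0 ≤ codeMin N Pv bv f := by
  have h := le_minLoad_iff.1 (le_refl (codeMin N Pv bv 0))
  exact le_minLoad_iff.2 ⟨h.1, fun i hi hb => (h.2 i hi hb).trans (by simp)⟩

theorem le_better_left (e f : ℕ) : codeMin N Pv bv e ≤ codeMin N Pv bv (better N bv Pv e f) := by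
  unfold better
  split_ifs with h
  · exact le_rfl
  · simp only [mul_eq_zero, not_or] at h
    omega

theorem better_ne_zero {e : ℕ} (he : e ≠ 0) (f : ℕ) : better N bv Pv e f ≠ 0 := by
  unfold better
  split_ifs with h
  · exact he
  · simp only [mul_eq_zero, not_or] at h
    exact h.1

/-- Ties go to the newer candidate. This is why the initial zero is replaced even by a schedule of
least load zero. -/
theorem le_better_right (e : ℕ) {f : ℕ} (hf : f ≠ 0) : better N bv Pv e f ≠ 0 ∧
    codeMin N Pv bv f ≤ codeMin N Pv bv (better N bv Pv e f) := by
  unfold better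
  split_ifs with h
  · simp only [mul_eq_zero, hf, false_or] at h
    refine ⟨?_, by omega⟩
    rintro rfl
    have := codeMin_zero_le (N := N) (Pv := Pv) (bv := bv) f
    omega
  · exact ⟨hf, le_rfl⟩

theorem Beats.better {d k e : ℕ} (h : Beats N m K pv bv Pv d k e) (f : ℕ) :
    Beats N m K pv bv Pv d k (better N bv Pv e f) := fun y hy hc =>
  ⟨better_ne_zero (h y hy hc).1 f, (h y hy hc).2.trans (le_better_left e f)⟩

theorem Beats.succ {d k e : ℕ} (h : Beats N m K pv bv Pv d k e) :
    Beats N m K pv bv Pv d (k + 1)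
      (MaxMinInput.better N bv Pv e (cell N m K pv bv Pv d m k)) := by
  intro y hy hc
  rcases Nat.lt_succ_iff_lt_or_eq.1 hy with hy | rfl
  exacts [h.better _ y hy hc, le_better_right _ hc]

/-- Invariant of the max-min subroutine after `t` passes. -/
def Invariant (N m K : ℕ) (pv : ℕ → ℕ → ℕ) (bv : ℕ → ℕ) (Pv : ℕ) (σ : State) (t : ℕ)
    (τ : State) : Prop :=
  Agree σ τ ∧ τ 10 0 = 2 ^ t ∧ IsCode N m pv bv Pv (τ 11 0) ∧
    ∀ t' < t, Beats N m K pv bv Pv (2 ^ t') (layer N m K) (τ 11 0)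

/-- Numbers of `B` bits suffice for the max-min subroutine. -/
structure Fits (N m K Pv B : ℕ) : Prop where
  cells : (m + 1) * layer N m K < 2 ^ B
  codes : (Pv + 1) ^ N * N ^ m < 2 ^ B
  unit : 2 * (Pv + 1) < 2 ^ B

/-- Bound for the number of steps of a pass. -/
def passSteps (N m K : ℕ) : ℕ := (m + 1) * layer N m K * 4 + 3 + (layer N m K * 4 + 3 + 1 + 1) + 1

/-- The table of the previous unit need not be erased: cells are filled in increasing order, and the
proof relies only on cells already rewritten. -/
theorem reaches_maxMinPass (hN : 0 < N) {B : ℕ} (h : MaxMinInput N m K p b P pv bv Pv σ)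
    (hB : Fits N m K Pv B) {t : ℕ} (ht : t < Nat.size (Pv + 1)) (hτ : Bounded B τ)
    (hI : Invariant N m K pv bv Pv σ t τ) :
    Reaches B (.maxMinPass N p b P) τ (passSteps N m K) (Invariant N m K pv bv Pv σ (t + 1)) := by
  obtain ⟨hag, hd, hcode, hbeats⟩ := hI
  have hR := layer_pos N m K
  have hRm : layer N m K ≤ (m + 1) * layer N m K := Nat.le_mul_of_pos_left _ (by omega)
  have hRB : layer N m K < 2 ^ B := lt_of_le_of_lt hRm hB.cells
  set e₀ := τ 11 0 with he₀
  refine Reaches.seq (mid := fun ρ => Agree σ ρ ∧ ρ 10 0 = 2 ^ t ∧ ρ 11 0 = e₀ ∧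
      ∀ z < (m + 1) * layer N m K, ρ 7 z =
        cell N m K pv bv Pv (2 ^ t) (z / layer N m K) (z % layer N m K)) ?_ ?_
  · refine reaches_for 8 _ (fun k ρ => Agree σ ρ ∧ ρ 10 0 = 2 ^ t ∧ ρ 11 0 = e₀ ∧
      ∀ z < k, ρ 7 z = cell N m K pv bv Pv (2 ^ t) (z / layer N m K) (z % layer N m K))
      ((m + 1) * layer N m K) 1 hB.cells ?_ ?_ ?_ hτ ?_
    · rintro k ρ x ⟨h₁, h₂, h₃, h₄⟩
      refine ⟨h₁.set (by norm_num) _ _, ?_, ?_, fun z hz => ?_⟩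
      · rwa [State.set_of_ne _ (by norm_num)]
      · rwa [State.set_of_ne _ (by norm_num)]
      · rw [State.set_of_ne _ (by norm_num), h₄ z hz]
    · rintro k ρ ⟨h₁, -⟩
      simp [Expr.eval, h.eval_items h₁, h.eval_layerSize h₁]
    · rintro k hk ρ hρ ⟨h₁, h₂, h₃, h₄⟩ h₅
      have he := h.eval_tableE h₁ h₂ h₅ hk h₄
      have hkm : k / layer N m K ≤ m := by
        have : k / layer N m K < m + 1 := Nat.div_lt_of_lt_mul (by rwa [mul_comm])
        omega
      refine reaches_write _ _ _ hρ ?_ ⟨⟨h₁.set le_rfl _ _, ?_, ?_, fun z hz => ?_⟩, ?_⟩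
      · rw [he]
        exact (h.isCode_le hN hkm (cell_isCode _ _ _)).trans_lt hB.codes
      · rwa [State.set_of_ne _ (by norm_num)]
      · rwa [State.set_of_ne _ (by norm_num)]
      · rw [State.set_self, Expr.eval_var, h₅, he]
        split_ifs with hzk
        · rw [hzk]
        · exact h₄ z (by omega)
      · rwa [State.set_of_ne _ (by norm_num)]
    · exact ⟨hag, hd, rfl, fun z hz => absurd hz (Nat.not_lt_zero z)⟩
  rintro ρ hρ ⟨h₁, h₂, h₃, h₄⟩
  have hlast : ∀ y < layer N m K, ρ 7 (m * layer N m K + y) =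
      cell N m K pv bv Pv (2 ^ t) m y := fun y hy => by
    rw [h₄ _ (by rw [add_mul]; omega), mul_comm m, Nat.mul_add_div hR, Nat.mul_add_mod,
      Nat.div_eq_of_lt hy, Nat.mod_eq_of_lt hy, add_zero]
  refine Reaches.seq (n := layer N m K * 4 + 3) (k := 1)
      (mid := fun ρ => Agree σ ρ ∧ ρ 10 0 = 2 ^ t ∧ IsCode N m pv bv Pv (ρ 11 0) ∧
        ∀ t' < t + 1, Beats N m K pv bv Pv (2 ^ t') (layer N m K) (ρ 11 0)) ?_ ?_
  · refine (reaches_for 9 _ (fun k ρ => Agree σ ρ ∧ ρ 10 0 = 2 ^ t ∧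
      (∀ y < layer N m K, ρ 7 (m * layer N m K + y) = cell N m K pv bv Pv (2 ^ t) m y) ∧
      IsCode N m pv bv Pv (ρ 11 0) ∧
      (∀ t' < t, Beats N m K pv bv Pv (2 ^ t') (layer N m K) (ρ 11 0)) ∧
      Beats N m K pv bv Pv (2 ^ t) k (ρ 11 0)) (layer N m K) 1 hRB ?_ ?_ ?_ hρ ?_).imp ?_
    · rintro k ρ x ⟨h₁, h₂⟩
      refine ⟨h₁.set (by norm_num) _ _, ?_⟩
      simp only [ne_eq, Nat.reduceEqDiff, not_false_eq_true, State.set_of_ne]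
      exact h₂
    · rintro k ρ ⟨h₁, -⟩
      exact h.eval_layerSize h₁
    · rintro k hk ρ hρ ⟨h₁, h₂, h₃, h₄, h₅, h₆⟩ h₇
      have he := h.eval_betterE h₁ h₇ hk h₃
      have hc : IsCode N m pv bv Pv
          (better N bv Pv (ρ 11 0) (cell N m K pv bv Pv (2 ^ t) m k)) := by
        rcases better_eq_or (N := N) (bv := bv) (Pv := Pv) (ρ 11 0)
          (cell N m K pv bv Pv (2 ^ t) m k) with hb | hb <;> rw [hb]
        exacts [h₄, cell_isCode _ _ _]
      refine reaches_write _ _ _ hρ ?_ ?_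
      · rw [he]
        exact (h.isCode_le hN le_rfl hc).trans_lt hB.codes
      · simp only [ne_eq, Nat.reduceEqDiff, not_false_eq_true, State.set_of_ne, Expr.eval,
          State.set_same, he]
        exact ⟨⟨h₁.set (by norm_num) _ _, h₂, h₃, hc, fun t' ht' => (h₅ t' ht').better _,
          h₆.succ⟩, h₇⟩
    · exact ⟨h₁, h₂, hlast, by rwa [h₃], by rwa [h₃], fun y hy => absurd hy (Nat.not_lt_zero y)⟩
    · rintro ρ - ⟨h₁, h₂, -, h₄, h₅, h₆⟩
      refine ⟨h₁, h₂, h₄, fun t' ht' => ?_⟩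
      rcases Nat.lt_succ_iff_lt_or_eq.1 ht' with ht' | rfl
      exacts [h₅ t' ht', h₆]
  · rintro ρ hρ ⟨h₁, h₂, h₃, h₄⟩
    refine reaches_write _ _ _ hρ ?_ ⟨h₁.set (by norm_num) _ _, ?_, ?_⟩
    · have := Nat.lt_size.1 ht
      have := hB.unit
      simp only [Expr.eval, Expr.eval_var, h₂]
      omega
    · simp [Expr.eval, h₂, pow_succ, mul_comm]
    · rw [State.set_of_ne _ (by norm_num)]
      exact ⟨h₃, h₄⟩

/-- Bound for the number of steps of the max-min subroutine. -/
def steps (N m K Pv : ℕ) : ℕ := 1 + (1 + (Nat.size (Pv + 1) * (passSteps N m K + 1) + 1) + 1) + 1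

/-- Each competitor `T` has its own good unit from `exists_unit`. In that pass the cell of the
rounded loads of `T` is occupied, perhaps by another schedule, which is almost as good as `T`; the
final code beats it. -/
theorem reaches_maxMin (hN : 0 < N) (hK : 0 < K) {B : ℕ}
    (h : MaxMinInput N m K p b P pv bv Pv σ) (hB : Fits N m K Pv B) (hσ : Bounded B σ) :
    Reaches B (.maxMin N p b P) σ (steps N m K Pv) fun τ => Agree σ τ ∧
      IsCode N m pv bv Pv (τ 11 0) ∧ ∀ T, Feasible N bv m T → τ 11 0 ≠ 0 ∧
        (K - 1) * minLoad Pv bv (load pv T m) N ≤ K * codeMin N Pv bv (τ 11 0) := by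
  have hag : Agree σ σ := fun a _ => rfl
  have h2B : 2 ≤ 2 ^ B := by have := hB.unit; omega
  have hloop : Reaches B (.maxMin N p b P) σ (steps N m K Pv)
      (Invariant N m K pv bv Pv σ (Nat.size (Pv + 1))) := by
    refine Reaches.seq (mid := fun τ => Agree σ τ ∧ τ 11 0 = 0)
      (reaches_write _ _ _ hσ (by simp [Expr.eval]) ⟨hag.set (by norm_num) _ _,
        by simp [Expr.eval]⟩) ?_
    rintro τ hτ ⟨h₁, h₂⟩
    refine Reaches.seq (mid := Invariant N m K pv bv Pv σ 0) (reaches_write _ _ _ hτ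
      (by simp only [Expr.eval]; omega) ⟨h₁.set (by norm_num) _ _, by simp [Expr.eval], ?_,
        fun t ht => absurd ht (Nat.not_lt_zero t)⟩) ?_
    · rw [State.set_of_ne _ (by norm_num), h₂]
      exact .inl rfl
    · intro τ hτ hI
      refine reaches_loop _ _ _ _ ?_ ?_ hτ hI
      · intro t ht ρ hρ hI
        refine ⟨?_, h.reaches_maxMinPass hN hB ht hρ hI⟩
        -- `2 ^ t ≤ Pv + 1` holds exactly for `t < Nat.size (Pv + 1)`, so the guard `Pv + 2 - 2 ^ t`
        -- is nonzero in just these passes.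
        have := Nat.lt_size.1 ht
        simp only [Expr.eval, Expr.eval_var, h.bound ρ hI.1, hI.2.1]
        omega
      · intro ρ hI
        have := Nat.lt_size_self (Pv + 1)
        simp only [Expr.eval, Expr.eval_var, h.bound ρ hI.1, hI.2.1]
        omega
  refine hloop.imp fun τ _ ⟨h₁, _, h₃, h₄⟩ => ⟨h₁, h₃, fun T hT => ?_⟩
  obtain ⟨t, ht, hS⟩ := exists_unit (p := pv) hT hK Pv
  have hne : cell N m K pv bv Pv (2 ^ t) m
      (∑ j ∈ range m, rounded (2 * m * K) m (2 ^ t) pv (T j) j) ≠ 0 := table_ne_zero hT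
  obtain ⟨h₅, h₆⟩ := h₄ t ht _ (sum_rounded_lt hT) hne
  refine ⟨h₅, ?_⟩
  obtain ⟨S, hSf, hSw, hSc⟩ := table_eq hne
  change cell N m K pv bv Pv (2 ^ t) m _ = code N Pv pv m S at hSc
  rw [hSc, codeMin_code h.sum_le hSf] at h₆
  exact (hS S hSf hSw).trans (Nat.mul_le_mul_left _ h₆)

end MaxMinInput

/-! ### The program -/

/-- Product of the denominators of the first `n` utilities. -/
def denProd (a : ℕ → ℕ) (n : ℕ) : ℕ := ∏ k ∈ range n, a (2 * k + 4)

/-- Bounds the total value of the first `n` utilities, multiplied by `denProd a n`. -/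
def sizeBound (a : ℕ → ℕ) (n : ℕ) : ℕ := ∏ k ∈ range n, (a (2 * k + 3) + 1) * a (2 * k + 4)

/-- The utility of item `j` for agent `i`, multiplied by `denProd a (N * m)`. -/
def scaled (a : ℕ → ℕ) (N m i j : ℕ) : ℕ :=
  a (2 * (i * m + j) + 3) * (denProd a (N * m) / a (2 * (i * m + j) + 4))

/-- The product of the positive shares. -/
def shareProd (c : ℕ → ℕ) (N : ℕ) : ℕ := ∏ i ∈ range N, (c i + (1 - c i))

/-- The utilities divided by the shares, up to a common factor. -/
def relative (a : ℕ → ℕ) (N m : ℕ) (c : ℕ → ℕ) (i j : ℕ) : ℕ :=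
  scaled a N m i j * (shareProd c N / c i)

namespace Expr

/-- The scaled utility of agent `i` for item `j`. -/
def scaledE (i : ℕ) (j : Expr) : Expr :=
  .mul (.read 0 (.add (.mul (.const 2) (.add (.mul (.const i) items) j)) (.const 3)))
    (.div (var 3) (.read 0 (.add (.mul (.const 2) (.add (.mul (.const i) items) j)) (.const 4))))

/-- Numerator of the share of agent `i`. -/
def share (i : ℕ) : Expr := .read 1 (.const (2 * i + 4))

/-- The product of the positive shares. -/
def shareProdE : ℕ → Expr
  | 0 => .const 1
  | n + 1 => .mul (shareProdE n) (.add (share n) (.sub (.const 1) (share n)))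

/-- The relative utility of agent `i` for item `j`. -/
def relativeE (N i : ℕ) (j : Expr) : Expr := .mul (scaledE i j) (.div (shareProdE N) (share i))

/-- The bound on loads in the scheduling step. -/
def finalBound (N : ℕ) : Expr := .mul (var 4) (shareProdE N)

/-- The agent who receives the current item. -/
def receiver (N : ℕ) : Expr :=
  (Expr.div (.div (.sub (var 11) (.const 1)) (((finalBound N).add (.const 1)).pow N))
    (.read 5 (var 6))).mod (.const N)

theorem eval_shareProdE (τ : State) (n : ℕ) :
    (shareProdE n).eval τ = shareProd (fun i => τ 1 (2 * i + 4)) n := by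
  induction n with
  | zero => rfl
  | succ n ih => simp only [shareProdE, eval, ih, shareProd, prod_range_succ, share]

end Expr

namespace Prog

/-- Write the accuracies `α` and `β`, and the first entries of products. -/
def start : Prog :=
  .seq (.write 1 (.const 0) (.sub .accuracy (.const 1))) (.seq (.write 1 (.const 1) .accuracy)
    (.seq (.write 1 (.const 2) (.sub .accuracy (.const 1))) (.seq (.write 1 (.const 3) .accuracy)
      (.seq (.write 3 (.const 0) (.const 1)) (.seq (.write 4 (.const 0) (.const 1))
        (.write 5 (.const 0) (.const 1)))))))

/-- Compute the products of denominators, the bound for utilities and the powers of `N`. -/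
def products (N : ℕ) : Prog :=
  .for 6 (.mul (.const N) .items)
    (.seq (.write 3 (.const 0)
        (.mul (.var 3) (.read 0 (.add (.mul (.const 2) (.var 6)) (.const 4)))))
      (.seq (.write 4 (.const 0) (.mul (.var 4)
          (.mul (.add (.read 0 (.add (.mul (.const 2) (.var 6)) (.const 3))) (.const 1))
            (.read 0 (.add (.mul (.const 2) (.var 6)) (.const 4))))))
        (.write 5 (.add (.var 6) (.const 1)) (.mul (.read 5 (.var 6)) (.const N)))))

/-- Compute the shares of the first agents. -/
def shares (N : ℕ) : ℕ → Prog
  | 0 => .skip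
  | r + 1 => .seq (shares N r) (.seq (.maxMin N (fun _ => .scaledE r) (fun _ => .const 1) (.var 4))
      (.seq (.write 1 (.const (2 * r + 4))
          (.codeMinE N (fun _ => .const 1) (.var 4) (.var 11)))
        (.write 1 (.const (2 * r + 5)) (.var 3))))

/-- Compute the allocation. -/
def allocate (N : ℕ) : Prog :=
  .seq (.maxMin N (.relativeE N) .share (.finalBound N))
    (.for 6 .items (.write 2 (.var 6) (.receiver N)))

/-- The approximation scheme. -/
def scheme (N : ℕ) : Prog := .seq start (.seq (products N) (.seq (shares N N) (allocate N)))

end Prog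

/-! ### Bounds on scaled and relative utilities -/

section Bounds

theorem sum_le_prod_add_one (x : ℕ → ℕ) (n : ℕ) :
    ∑ k ∈ range n, x k ≤ ∏ k ∈ range n, (x k + 1) := by
  have : ∑ k ∈ range n, x k + 1 ≤ ∏ k ∈ range n, (x k + 1) := by
    induction n with
    | zero => simp
    | succ n ih =>
      rw [sum_range_succ, prod_range_succ]
      nlinarith [Nat.zero_le (∑ k ∈ range n, x k * x n), Nat.zero_le (∑ k ∈ range n, x k),
        Nat.zero_le (x n)]
  omega

theorem sum_block_le (x : ℕ → ℕ) {N m i : ℕ} (hi : i < N) :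
    ∑ j ∈ range m, x (i * m + j) ≤ ∑ k ∈ range (N * m), x k := by
  obtain ⟨l, hl⟩ : ∃ l, N * m = i * m + (m + l) := by
    obtain ⟨k, rfl⟩ := Nat.exists_eq_add_of_lt hi
    exact ⟨k * m, by ring⟩
  rw [hl, sum_range_add, sum_range_add]
  omega

variable {a : ℕ → ℕ} {N m : ℕ}

/-- Crude but computable by a running product: a sum of numerators is at most the product of the
numerators plus one. -/
theorem sum_scaled_le {i : ℕ} (hi : i < N) :
    ∑ j ∈ range m, scaled a N m i j ≤ sizeBound a (N * m) := by
  calc ∑ j ∈ range m, scaled a N m i j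
      ≤ ∑ j ∈ range m, a (2 * (i * m + j) + 3) * denProd a (N * m) :=
        sum_le_sum fun j _ => Nat.mul_le_mul_left _ (Nat.div_le_self _ _)
    _ = (∑ j ∈ range m, a (2 * (i * m + j) + 3)) * denProd a (N * m) := (sum_mul _ _ _).symm
    _ ≤ (∏ k ∈ range (N * m), (a (2 * k + 3) + 1)) * denProd a (N * m) :=
        Nat.mul_le_mul_right _ ((sum_block_le (fun k => a (2 * k + 3)) hi).trans
          (sum_le_prod_add_one _ _))
    _ = sizeBound a (N * m) := by rw [sizeBound, prod_mul_distrib, denProd]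

theorem sum_relative_le (c : ℕ → ℕ) {i : ℕ} (hi : i < N) :
    ∑ j ∈ range m, relative a N m c i j ≤ sizeBound a (N * m) * shareProd c N := by
  simp only [relative]
  rw [← sum_mul]
  exact Nat.mul_le_mul (sum_scaled_le hi) (Nat.div_le_self _ _)

theorem sizeBound_mono (ha : ∀ k < N * m, a (2 * k + 4) ≠ 0) {n : ℕ} (hn : n ≤ N * m) :
    sizeBound a n ≤ sizeBound a (N * m) := by
  refine prod_le_prod_of_subset_of_one_le' (range_subset_range.2 hn) fun k hk _ => ?_
  have := Nat.pos_of_ne_zero (ha k (mem_range.1 hk))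
  exact Nat.mul_pos (Nat.succ_pos _) this

theorem sizeBound_pos (ha : ∀ k < N * m, a (2 * k + 4) ≠ 0) : 0 < sizeBound a (N * m) :=
  (sizeBound_mono ha (Nat.zero_le _)).trans_lt' (by simp [sizeBound])

theorem denProd_le_sizeBound (n : ℕ) : denProd a n ≤ sizeBound a n :=
  prod_le_prod' fun _ _ => Nat.le_mul_of_pos_left _ (Nat.succ_pos _)

/-- A zero share enters the product as a factor one, which `hG` covers. -/
theorem shareProd_le {c : ℕ → ℕ} {G : ℕ} (hG : 0 < G) (hc : ∀ i < N, c i ≤ G) :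
    shareProd c N ≤ G ^ N := by
  refine (prod_le_prod' (g := fun _ => G) fun i hi => ?_).trans (by simp)
  have := hc i (mem_range.1 hi)
  omega

end Bounds

/-- The results of the preparations. -/
structure Ready (N m K : ℕ) (a : ℕ → ℕ) (τ : State) : Prop where
  input : τ 0 = a
  den : τ 3 0 = denProd a (N * m)
  size : τ 4 0 = sizeBound a (N * m)
  powers : ∀ j ≤ N * m, τ 5 j = N ^ j
  alpha : τ 1 0 = K - 1 ∧ τ 1 1 = K
  beta : τ 1 2 = K - 1 ∧ τ 1 3 = K

/-- A valid input. -/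
structure ValidInput (N m K : ℕ) (a : ℕ → ℕ) : Prop where
  agents : 0 < N
  accuracy : 2 * a 1 = K
  accuracy_pos : 0 < K
  items : a 2 = m
  den : ∀ k < N * m, a (2 * k + 4) ≠ 0

/-- Numbers of `B` bits suffice for the program. -/
structure Suffices (N m K : ℕ) (a : ℕ → ℕ) (B : ℕ) : Prop where
  fits : MaxMinInput.Fits N m K (sizeBound a (N * m) ^ (N + 1)) B
  accuracy : K < 2 ^ B
  count : N * m < 2 ^ B
  powers : N ^ (N * m) < 2 ^ B

/-! ### The two calls of the max-min subroutine as valid inputs -/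

namespace Ready

variable {N m K B : ℕ} {a : ℕ → ℕ} {σ τ : State}

theorem agree (h : Ready N m K a σ) (hτ : Agree σ τ) : Ready N m K a τ := by
  constructor
  · rw [hτ 0 (by norm_num), h.input]
  · rw [hτ 3 (by norm_num), h.den]
  · rw [hτ 4 (by norm_num), h.size]
  · rw [hτ 5 (by norm_num)]; exact h.powers
  · rw [hτ 1 (by norm_num)]; exact h.alpha
  · rw [hτ 1 (by norm_num)]; exact h.beta

theorem set (h : Ready N m K a τ) {b : ℕ} (hb : b = 2 ∨ b = 6) (k v : ℕ) :
    Ready N m K a (τ.set b k v) := by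
  constructor <;> rw [State.set_of_ne _ (by omega)]
  exacts [h.input, h.den, h.size, h.powers, h.alpha, h.beta]

theorem set_share (h : Ready N m K a τ) {k : ℕ} (hk : 4 ≤ k) (v : ℕ) :
    Ready N m K a (τ.set 1 k v) := by
  constructor
  · rw [State.set_of_ne _ (by norm_num)]; exact h.input
  · rw [State.set_of_ne _ (by norm_num)]; exact h.den
  · rw [State.set_of_ne _ (by norm_num)]; exact h.size
  · rw [State.set_of_ne _ (by norm_num)]; exact h.powers
  · simp only [State.set_self]
    rw [if_neg (by omega), if_neg (by omega)]; exact h.alpha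
  · simp only [State.set_self]
    rw [if_neg (by omega), if_neg (by omega)]; exact h.beta

theorem eval_scaledE (h : Ready N m K a τ) (ha : ValidInput N m K a) (i : ℕ) (e : Expr) :
    (Expr.scaledE i e).eval τ = scaled a N m i (e.eval τ) := by
  simp [Expr.scaledE, Expr.eval, Expr.items, h.input, ha.items, h.den, scaled]

theorem eval_relativeE (h : Ready N m K a τ) (ha : ValidInput N m K a) (i : ℕ) (e : Expr) :
    (Expr.relativeE N i e).eval τ =
      relative a N m (fun i => τ 1 (2 * i + 4)) i (e.eval τ) := by
  simp [Expr.relativeE, Expr.eval, h.eval_scaledE ha, Expr.eval_shareProdE, Expr.share, relative]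

/-- All machines value items like agent `r` and all are active, so the optimum is the scaled max-min
share of `r`. -/
theorem maxMinInput_share (h : Ready N m K a σ) (ha : ValidInput N m K a) {r : ℕ} (hr : r < N) :
    MaxMinInput N m K (fun _ => .scaledE r) (fun _ => .const 1) (.var 4)
      (fun _ => scaled a N m r) (fun _ => 1) (sizeBound a (N * m)) σ where
  items := by rw [h.input, ha.items]
  accuracy := by rw [h.input, ha.accuracy]
  powers j hj := h.powers j (hj.le.trans (Nat.le_mul_of_pos_left _ ha.agents))
  time τ hτ _ e := (h.agree hτ).eval_scaledE ha r e
  mask _ _ _ := rfl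
  bound τ hτ := (h.agree hτ).size
  sum_le _ _ := sum_scaled_le hr

/-- The share numerators themselves serve as the mask, so exactly the agents with positive shares
take part. -/
theorem maxMinInput_allocate (h : Ready N m K a σ) (ha : ValidInput N m K a) :
    MaxMinInput N m K (.relativeE N) .share (.finalBound N)
      (relative a N m fun i => σ 1 (2 * i + 4)) (fun i => σ 1 (2 * i + 4))
      (sizeBound a (N * m) * shareProd (fun i => σ 1 (2 * i + 4)) N) σ where
  items := by rw [h.input, ha.items]
  accuracy := by rw [h.input, ha.accuracy]
  powers j hj := h.powers j (hj.le.trans (Nat.le_mul_of_pos_left _ ha.agents))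
  time τ hτ i e := by rw [(h.agree hτ).eval_relativeE ha i e, hτ 1 (by norm_num)]
  mask τ hτ i := by simp [Expr.share, Expr.eval, hτ 1 (by norm_num)]
  bound τ hτ := by
    simp only [Expr.finalBound, Expr.eval, Expr.eval_var, Expr.eval_shareProdE,
      (h.agree hτ).size, hτ 1 (by norm_num)]
  sum_le _ hi := sum_relative_le _ hi

end Ready

theorem MaxMinInput.Fits.mono {N m K P P' B : ℕ} (h : Fits N m K P B) (hP : P' ≤ P) :
    Fits N m K P' B where
  cells := h.cells
  codes := lt_of_le_of_lt (by gcongr) h.codes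
  unit := by have := h.unit; omega

theorem MaxMinInput.steps_mono {N m K P P' : ℕ} (hP : P' ≤ P) :
    steps N m K P' ≤ steps N m K P := by
  have : Nat.size (P' + 1) ≤ Nat.size (P + 1) := Nat.size_le_size (by omega)
  unfold steps
  gcongr

/-! ### Correctness of the stages of the program -/

section Program

variable {N m K B : ℕ} {a : ℕ → ℕ} {σ : State}

theorem reaches_start (ha : ValidInput N m K a) (hB : Suffices N m K a B) (hσ : Bounded B σ)
    (h0 : σ 0 = a) :
    Reaches B Prog.start σ 13 fun τ => τ 0 = a ∧ τ 3 0 = 1 ∧ τ 4 0 = 1 ∧ τ 5 0 = 1 ∧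
      (τ 1 0 = K - 1 ∧ τ 1 1 = K) ∧ τ 1 2 = K - 1 ∧ τ 1 3 = K := by
  have hK := hB.accuracy
  have h1 : 1 < 2 ^ B := by have := ha.accuracy_pos; omega
  have hacc : ∀ τ : State, τ 0 = a → Expr.accuracy.eval τ = K := fun τ h => by
    simp [Expr.accuracy, Expr.eval, h, ha.accuracy]
  refine Reaches.seq (mid := fun τ => τ 0 = a ∧ τ 1 0 = K - 1) (n := 1) (k := 11)
    (reaches_write _ _ _ hσ ?_ ?_) ?_
  · simp only [Expr.eval, hacc σ h0]; omega
  · simp [Expr.eval, hacc σ h0, h0, State.set_of_ne]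
  rintro σ hσ ⟨h0, h₁⟩
  refine Reaches.seq (mid := fun τ => τ 0 = a ∧ τ 1 0 = K - 1 ∧ τ 1 1 = K) (n := 1) (k := 9)
    (reaches_write _ _ _ hσ ?_ ?_) ?_
  · simpa only [Expr.eval, hacc σ h0]
  · simp [Expr.eval, hacc σ h0, h0, State.set_of_ne, State.set_self, h₁]
  rintro σ hσ ⟨h0, h₁, h₂⟩
  refine Reaches.seq (mid := fun τ => τ 0 = a ∧ τ 1 0 = K - 1 ∧ τ 1 1 = K ∧ τ 1 2 = K - 1)
    (n := 1) (k := 7) (reaches_write _ _ _ hσ ?_ ?_) ?_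
  · simp only [Expr.eval, hacc σ h0]; omega
  · simp [Expr.eval, hacc σ h0, h0, State.set_of_ne, State.set_self, h₁, h₂]
  rintro σ hσ ⟨h0, h₁, h₂, h₃⟩
  refine Reaches.seq (mid := fun τ => τ 0 = a ∧ (τ 1 0 = K - 1 ∧ τ 1 1 = K) ∧ τ 1 2 = K - 1 ∧
    τ 1 3 = K) (n := 1) (k := 5) (reaches_write _ _ _ hσ ?_ ?_) ?_
  · simpa only [Expr.eval, hacc σ h0]
  · simp [Expr.eval, hacc σ h0, h0, State.set_of_ne, State.set_self, h₁, h₂, h₃]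
  rintro σ hσ ⟨h0, h₁⟩
  refine Reaches.seq (mid := fun τ => τ 0 = a ∧ τ 3 0 = 1 ∧ (τ 1 0 = K - 1 ∧ τ 1 1 = K) ∧
    τ 1 2 = K - 1 ∧ τ 1 3 = K) (n := 1) (k := 3) (reaches_write _ _ _ hσ ?_ ?_) ?_
  · simpa only [Expr.eval]
  · simpa [Expr.eval, h0, State.set_of_ne] using h₁
  rintro σ hσ ⟨h0, h₁, h₂⟩
  refine Reaches.seq (mid := fun τ => τ 0 = a ∧ τ 3 0 = 1 ∧ τ 4 0 = 1 ∧
    (τ 1 0 = K - 1 ∧ τ 1 1 = K) ∧ τ 1 2 = K - 1 ∧ τ 1 3 = K) (n := 1) (k := 1)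
    (reaches_write _ _ _ hσ ?_ ?_) ?_
  · simpa only [Expr.eval]
  · simpa [Expr.eval, h0, h₁, State.set_of_ne] using h₂
  rintro σ hσ ⟨h0, h₁, h₂, h₃⟩
  refine reaches_write _ _ _ hσ ?_ ?_
  · simpa only [Expr.eval]
  · simpa [Expr.eval, h0, h₁, h₂, State.set_of_ne] using h₃

theorem reaches_products (ha : ValidInput N m K a) (hB : Suffices N m K a B) (hσ : Bounded B σ)
    (h0 : σ 0 = a) (h3 : σ 3 0 = 1) (h4 : σ 4 0 = 1) (h5 : σ 5 0 = 1)
    (hα : σ 1 0 = K - 1 ∧ σ 1 1 = K) (hβ : σ 1 2 = K - 1 ∧ σ 1 3 = K) :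
    Reaches B (Prog.products N) σ (N * m * 8 + 3) (Ready N m K a) := by
  have hG := sizeBound_pos ha.den
  have hGB : sizeBound a (N * m) < 2 ^ B := by
    have h₁ := hB.fits.unit
    have h₂ : sizeBound a (N * m) ≤ sizeBound a (N * m) ^ (N + 1) :=
      Nat.le_self_pow (by omega) _
    omega
  refine (reaches_for 6 _ (fun k τ => τ 0 = a ∧ τ 3 0 = denProd a k ∧ τ 4 0 = sizeBound a k ∧
    (∀ j ≤ k, τ 5 j = N ^ j) ∧ τ 1 = σ 1) (N * m) 5 hB.count ?_ ?_ ?_ hσ ?_).imp ?_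
  · rintro k τ x h
    simpa [State.set_of_ne] using h
  · rintro k τ ⟨h₁, -⟩
    simp [Expr.eval, Expr.items, h₁, ha.items]
  · rintro k hk τ hτ ⟨h₁, h₂, h₃, h₄, h₅⟩ h₆
    have hG' : sizeBound a (k + 1) < 2 ^ B := (sizeBound_mono ha.den hk).trans_lt hGB
    have hD : denProd a (k + 1) < 2 ^ B := (denProd_le_sizeBound _).trans_lt hG'
    refine Reaches.seq (mid := fun τ => τ 0 = a ∧ τ 3 0 = denProd a (k + 1) ∧
      τ 4 0 = sizeBound a k ∧ (∀ j ≤ k, τ 5 j = N ^ j) ∧ τ 1 = σ 1 ∧ τ 6 0 = k) (n := 1) (k := 3)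
      (reaches_write _ _ _ hτ ?_ ?_) ?_
    · simpa [Expr.eval, h₁, h₂, h₆, denProd, prod_range_succ] using hD
    · simpa [Expr.eval, h₁, h₂, h₆, denProd, prod_range_succ, State.set_of_ne] using ⟨h₃, h₄, h₅⟩
    rintro τ hτ ⟨h₁, h₂, h₃, h₄, h₅, h₆⟩
    refine Reaches.seq (mid := fun τ => τ 0 = a ∧ τ 3 0 = denProd a (k + 1) ∧
      τ 4 0 = sizeBound a (k + 1) ∧ (∀ j ≤ k, τ 5 j = N ^ j) ∧ τ 1 = σ 1 ∧ τ 6 0 = k) (n := 1)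
      (k := 1) (reaches_write _ _ _ hτ ?_ ?_) ?_
    · simpa [Expr.eval, h₁, h₃, h₆, sizeBound, prod_range_succ] using hG'
    · simpa [Expr.eval, h₁, h₂, h₃, h₆, sizeBound, prod_range_succ, State.set_of_ne]
        using ⟨h₄, h₅⟩
    rintro τ hτ ⟨h₁, h₂, h₃, h₄, h₅, h₆⟩
    refine reaches_write _ _ _ hτ ?_ ⟨⟨?_, ?_, ?_, fun j hj => ?_, ?_⟩, ?_⟩
    · simp only [Expr.eval, Expr.eval_var, h₆, h₄ k le_rfl, ← pow_succ]
      exact (Nat.pow_le_pow_right ha.agents hk).trans_lt hB.powers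
    · rwa [State.set_of_ne _ (by norm_num)]
    · rwa [State.set_of_ne _ (by norm_num)]
    · rwa [State.set_of_ne _ (by norm_num)]
    · simp only [Expr.eval, Expr.eval_var, h₆, h₄ k le_rfl, State.set_self]
      split_ifs with h
      · rw [h, pow_succ]
      · exact h₄ j (by omega)
    · rwa [State.set_of_ne _ (by norm_num)]
    · rwa [State.set_of_ne _ (by norm_num)]
  · exact ⟨h0, by simpa [denProd] using h3, by simpa [sizeBound] using h4, by simpa using h5, rfl⟩
  · rintro τ - ⟨h₁, h₂, h₃, h₄, h₅⟩
    exact ⟨h₁, h₂, h₃, h₄, by rwa [h₅], by rwa [h₅]⟩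

/-- `c` is a share of agent `r` with accuracy `(K - 1) / K`, for the scaled utilities. -/
def IsShare (N m K : ℕ) (a : ℕ → ℕ) (r c : ℕ) : Prop :=
  (∃ S, Feasible N (fun _ => 1) m S ∧ c = minLoad (sizeBound a (N * m)) (fun _ => 1)
    (load (fun _ => scaled a N m r) S m) N) ∧
  ∀ T, Feasible N (fun _ => 1) m T → (K - 1) * minLoad (sizeBound a (N * m)) (fun _ => 1)
    (load (fun _ => scaled a N m r) T m) N ≤ K * c

theorem IsShare.le {r c : ℕ} (h : IsShare N m K a r c) : c ≤ sizeBound a (N * m) := by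
  obtain ⟨⟨S, -, rfl⟩, -⟩ := h
  exact (le_minLoad_iff.1 le_rfl).1

/-- Bound for the number of steps of a call of the max-min subroutine in the program. -/
def callSteps (N m K : ℕ) (a : ℕ → ℕ) : ℕ :=
  MaxMinInput.steps N m K (sizeBound a (N * m) ^ (N + 1))

theorem reaches_shares (ha : ValidInput N m K a) (hB : Suffices N m K a B) (hσ : Bounded B σ)
    (h : Ready N m K a σ) {r : ℕ} (hr : r ≤ N) :
    Reaches B (Prog.shares N r) σ (r * (callSteps N m K a + 5) + 1) fun τ => Ready N m K a τ ∧
      ∀ i < r, IsShare N m K a i (τ 1 (2 * i + 4)) ∧ τ 1 (2 * i + 5) = denProd a (N * m) := by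
  have hG := sizeBound_pos ha.den
  have hGle : sizeBound a (N * m) ≤ sizeBound a (N * m) ^ (N + 1) := Nat.le_self_pow (by omega) _
  have hGB : sizeBound a (N * m) < 2 ^ B := by
    have h₁ := hB.fits.unit
    omega
  induction r with
  | zero =>
    refine ⟨σ, 1, .skip σ, ?_, hσ, h, fun i hi => absurd hi (Nat.not_lt_zero i)⟩
    simp only [Prog.shares, Prog.weight, zero_mul, zero_add, one_mul]
    exact Nat.one_le_pow _ _ (by omega)
  | succ r ih =>
    have hrN : r < N := hr
    refine ((ih hrN.le).seq (k := callSteps N m K a + 3 + 1) ?_).mono (by ring_nf; omega)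
    rintro τ hτ ⟨h₁, h₂⟩
    refine Reaches.seq (((h₁.maxMinInput_share ha hrN).reaches_maxMin ha.agents ha.accuracy_pos
      (hB.fits.mono hGle) hτ).mono (MaxMinInput.steps_mono hGle)) ?_
    rintro ρ hρ ⟨h₃, h₄, h₅⟩
    have hready := h₁.agree h₃
    have hshare : IsShare N m K a r (codeMin N (sizeBound a (N * m)) (fun _ => 1) (ρ 11 0)) := by
      refine ⟨?_, fun T hT => (h₅ T hT).2⟩
      -- With all machines active some schedule exists, so the returned value is a genuine code and
      -- not the initial zero.
      have h0 : Feasible N (fun _ => 1) m fun _ => 0 := fun _ _ => ⟨ha.agents, one_ne_zero⟩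
      obtain ⟨S, hS, he⟩ := h₄.resolve_left (h₅ _ h0).1
      exact ⟨S, hS, by rw [he, codeMin_code (fun _ _ => sum_scaled_le hrN) hS]⟩
    have heval : (Expr.codeMinE N (fun _ => .const 1) (.var 4) (.var 11)).eval ρ =
        codeMin N (sizeBound a (N * m)) (fun _ => 1) (ρ 11 0) := by
      simp only [Expr.eval_codeMinE, Expr.eval_var, hready.size, Expr.eval]
    rw [← h₃ 1 (by norm_num)] at h₂
    refine Reaches.seq (n := 1) (k := 1) (mid := fun ρ => Ready N m K a ρ ∧
      (∀ i < r, IsShare N m K a i (ρ 1 (2 * i + 4)) ∧ ρ 1 (2 * i + 5) = denProd a (N * m)) ∧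
      IsShare N m K a r (ρ 1 (2 * r + 4))) (reaches_write _ _ _ hρ ?_ ⟨?_, fun i hi => ?_, ?_⟩) ?_
    · rw [heval]
      exact hshare.le.trans_lt hGB
    · exact hready.set_share (by simp [Expr.eval]) _
    · simp only [State.set_self, Expr.eval]
      rw [if_neg (by omega), if_neg (by omega)]
      exact h₂ i hi
    · rw [heval]
      simpa [Expr.eval] using hshare
    rintro ρ hρ ⟨h₁, h₂, h₃⟩
    refine reaches_write _ _ _ hρ ?_ ⟨h₁.set_share (by simp [Expr.eval]) _, fun i hi => ?_⟩
    · rw [Expr.eval_var, h₁.den]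
      exact (denProd_le_sizeBound _).trans_lt hGB
    · simp only [State.set_self, Expr.eval, Expr.eval_var]
      rcases Nat.lt_succ_iff_lt_or_eq.1 hi with hi | rfl
      · rw [if_neg (by omega), if_neg (by omega)]
        exact h₂ i hi
      · rw [if_neg (by omega), if_pos rfl]
        exact ⟨h₃, h₁.den⟩

theorem load_congr {p : ℕ → ℕ → ℕ} {S T : ℕ → ℕ} (h : ∀ j < m, S j = T j) (i : ℕ) :
    load p S m i = load p T m i :=
  sum_congr rfl fun j hj => by rw [h j (mem_range.1 hj)]

/-- `S` is a schedule with accuracy `(K - 1) / K` for the utilities relative to the shares `c`. -/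
def IsSchedule (N m K : ℕ) (a c S : ℕ → ℕ) : Prop :=
  (∀ j < m, S j < N) ∧ ∀ T, Feasible N c m T → Feasible N c m S ∧
    (K - 1) * minLoad (sizeBound a (N * m) * shareProd c N) c (load (relative a N m c) T m) N ≤
      K * minLoad (sizeBound a (N * m) * shareProd c N) c (load (relative a N m c) S m) N

/-- If all shares vanish and there are items, no schedule is feasible. The remainder modulo `N`
still makes the output an allocation, and the algorithm allows any. -/
theorem reaches_allocate (ha : ValidInput N m K a) (hB : Suffices N m K a B) (hσ : Bounded B σ)
    (h : Ready N m K a σ) (hc : ∀ i < N, σ 1 (2 * i + 4) ≤ sizeBound a (N * m)) :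
    Reaches B (Prog.allocate N) σ (callSteps N m K a + (m * 4 + 3) + 1) fun τ =>
      Ready N m K a τ ∧ τ 1 = σ 1 ∧
      IsSchedule N m K a (fun i => σ 1 (2 * i + 4)) (τ 2) := by
  have hG := sizeBound_pos ha.den
  set c := fun i => σ 1 (2 * i + 4) with hcdef
  set P := sizeBound a (N * m) * shareProd c N with hP
  have hle : P ≤ sizeBound a (N * m) ^ (N + 1) := by
    rw [pow_succ']
    exact Nat.mul_le_mul_left _ (shareProd_le hG hc)
  have hin := h.maxMinInput_allocate ha
  have hmB : m < 2 ^ B := (Nat.le_mul_of_pos_left m ha.agents).trans_lt hB.count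
  -- Agent numbers are written only if there are items, and then `N ≤ N * m`.
  have hNB : N < 2 ^ B ∨ m = 0 := by
    rcases Nat.eq_zero_or_pos m with hm | hm
    · exact .inr hm
    · exact .inl ((Nat.le_mul_of_pos_right N hm).trans_lt hB.count)
  refine Reaches.seq ((hin.reaches_maxMin ha.agents ha.accuracy_pos (hB.fits.mono hle) hσ).mono
    (MaxMinInput.steps_mono hle)) ?_
  rintro τ hτ ⟨h₁, h₂, h₃⟩
  refine (reaches_for 6 _ (fun k ρ => Ready N m K a ρ ∧ ρ 1 = σ 1 ∧ ρ 11 0 = τ 11 0 ∧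
    ∀ j < k, ρ 2 j = codeMachine N P (τ 11 0) j) m 1 hmB ?_ ?_ ?_ hτ ?_).imp ?_
  · rintro k ρ x ⟨h₁, h₂⟩
    exact ⟨h₁.set (by norm_num) _ _, by simpa [State.set_of_ne] using h₂⟩
  · rintro k ρ ⟨h₁, -⟩
    simp [Expr.items, Expr.eval, h₁.input, ha.items]
  · rintro k hk ρ hρ ⟨h₄, h₅, h₆, h₇⟩ h₈
    have he : (Expr.receiver N).eval ρ = codeMachine N P (τ 11 0) k := by
      simp [Expr.receiver, Expr.finalBound, Expr.eval, Expr.eval_shareProdE, h₄.size, h₅, h₆, h₈,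
        h₄.powers k (hk.le.trans (Nat.le_mul_of_pos_left _ ha.agents)), codeMachine, hP, hcdef]
    refine reaches_write _ _ _ hρ ?_ ⟨⟨h₄.set (by norm_num) _ _, ?_, ?_, fun j hj => ?_⟩, ?_⟩
    · rw [he]
      exact (Nat.mod_lt _ ha.agents).trans (hNB.resolve_right (by omega))
    · rwa [State.set_of_ne _ (by norm_num)]
    · rwa [State.set_of_ne _ (by norm_num)]
    · rw [State.set_self, he, Expr.eval_var, h₈]
      split_ifs with hjk
      · rw [hjk]
      · exact h₇ j (by omega)
    · rwa [State.set_of_ne _ (by norm_num)]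
  · exact ⟨h.agree h₁, h₁ 1 (by norm_num), rfl, fun j hj => absurd hj (Nat.not_lt_zero j)⟩
  · rintro ρ - ⟨h₄, h₅, -, h₆⟩
    refine ⟨h₄, h₅, fun j hj => (h₆ j hj).trans_lt (Nat.mod_lt _ ha.agents), fun T hT => ?_⟩
    obtain ⟨h₇, h₈⟩ := h₃ T hT
    obtain ⟨S, hS, he⟩ := h₂.resolve_left h₇
    have hSρ : ∀ j < m, ρ 2 j = S j := fun j hj => by
      rw [h₆ j hj, he, codeMachine_code hin.sum_le hS hj]
    refine ⟨fun j hj => by rw [hSρ j hj]; exact hS j hj, ?_⟩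
    rw [he, codeMin_code hin.sum_le hS] at h₈
    rwa [minLoad_congr fun i _ => load_congr hSρ i]

/-- Bound for the number of steps of the program. -/
def schemeSteps (N m K : ℕ) (a : ℕ → ℕ) : ℕ :=
  13 + ((N * m * 8 + 3) + ((N * (callSteps N m K a + 5) + 1) +
    (callSteps N m K a + (m * 4 + 3) + 1) + 1) + 1) + 1

theorem reaches_scheme (ha : ValidInput N m K a) (hB : Suffices N m K a B) (hσ : Bounded B σ)
    (h0 : σ 0 = a) :
    Reaches B (Prog.scheme N) σ (schemeSteps N m K a) fun τ => Ready N m K a τ ∧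
      (∀ i < N, IsShare N m K a i (τ 1 (2 * i + 4)) ∧ τ 1 (2 * i + 5) = denProd a (N * m)) ∧
      IsSchedule N m K a (fun i => τ 1 (2 * i + 4)) (τ 2) := by
  refine (reaches_start ha hB hσ h0).seq ?_
  rintro τ hτ ⟨h₁, h₂, h₃, h₄, h₅, h₆⟩
  refine (reaches_products ha hB hτ h₁ h₂ h₃ h₄ h₅ h₆).seq fun τ hτ h => ?_
  refine (reaches_shares ha hB hτ h le_rfl).seq ?_
  rintro τ hτ ⟨h₁, h₂⟩
  refine (reaches_allocate ha hB hτ h₁ fun i hi => (h₂ i hi).1.le).imp ?_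
  rintro ρ - ⟨h₃, h₄, h₅⟩
  rw [h₄]
  exact ⟨h₃, h₂, h₅⟩

end Program

/-! ### Every execution is an approximation -/

theorem value_const_mul {M : Type*} (c : ℝ≥0) (v : M → ℝ≥0) (B : Finset M) :
    value (fun j => c * v j) B = c * value v B := (mul_sum _ _ _).symm

section CMin

variable {ι M : Type*} [DecidableEq ι] [Fintype M] {p : ι → M → ℝ≥0}

theorem le_cMin [Finite ι] [Nonempty ι] {x : ℝ≥0} {T : M → ι}
    (h : ∀ i, x ≤ value (p i) (bundle T i)) : x ≤ cMin p :=
  le_ciSup_of_le (Set.finite_range _).bddAbove T (le_ciInf h)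

theorem exists_cMin_le [Finite ι] [Nonempty ι] (p : ι → M → ℝ≥0) :
    ∃ T : M → ι, ∀ i, cMin p ≤ value (p i) (bundle T i) := by
  obtain ⟨T, hT⟩ := exists_eq_ciSup_of_finite
    (f := fun T : M → ι => ⨅ i : ι, value (p i) (bundle T i))
  refine ⟨T, fun i => ?_⟩
  have : cMin p = ⨅ i : ι, value (p i) (bundle T i) := hT.symm
  rw [this]
  exact ciInf_le (OrderBot.bddBelow _) i

end CMin

section Approximation

variable {N : ℕ} {M : Type*} [Fintype M] {u : Fin N → M → ℝ≥0} {ε : ℝ≥0}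

theorem exists_isRun (hN : 0 < N) (u : Fin N → M → ℝ≥0) (hε : 0 < ε) :
    ∃ r : Run N M, IsRun u ε r := by
  have hε' : (0 : ℝ) < ε := hε
  obtain ⟨x, hx0, hx1, hx⟩ : ∃ x : ℝ, 0 < x ∧ x < 1 ∧ 1 - (ε : ℝ) < x * x := by
    have h₁ : 0 < min (ε : ℝ) 1 := lt_min hε' one_pos
    have h₂ := min_le_left (ε : ℝ) 1
    have h₃ := min_le_right (ε : ℝ) 1
    -- Squaring gives more than `1 - min ε 1 / 2`; the minimum with one keeps the number positive
    -- for large `ε`.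
    exact ⟨1 - min (ε : ℝ) 1 / 4, by linarith, by linarith, by nlinarith⟩
  have hS : ∃ S : M → Fin N, (∃ i, 0 < mms u i) →
      ∃ T : M → {i : Fin N // 0 < mms u i},
        (∀ i : {i : Fin N // 0 < mms u i},
          cMin (fun (i : {i : Fin N // 0 < mms u i}) j => 1 / mms u i * u i j) ≤
          value (fun j => 1 / mms u i * u i j) (bundle T i)) ∧ ∀ j, S j = (T j : Fin N) := by
    by_cases h : ∃ i, 0 < mms u i
    · obtain ⟨i, hi⟩ := h
      have : Nonempty {i : Fin N // 0 < mms u i} := ⟨⟨i, hi⟩⟩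
      obtain ⟨T, hT⟩ := exists_cMin_le
        fun (i : {i : Fin N // 0 < mms u i}) j => 1 / mms u i * u i j
      exact ⟨fun j => T j, fun _ => ⟨T, hT, fun _ => rfl⟩⟩
    · exact ⟨fun _ => ⟨0, hN⟩, fun h' => absurd h' h⟩
  obtain ⟨S, hS⟩ := hS
  have hx1' : (⟨x, hx0.le⟩ : ℝ≥0) < 1 := hx1
  refine ⟨⟨⟨x, hx0.le⟩, ⟨x, hx0.le⟩, mms u, S⟩, ⟨hx0, hx1⟩, ⟨hx0, hx1⟩, hx, fun i => ⟨?_, le_rfl⟩,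
    fun h => ?_⟩
  · exact mul_le_of_le_one_left zero_le hx1'.le
  · obtain ⟨T, hT, hST⟩ := hS h
    exact ⟨T, fun i => (mul_le_of_le_one_left zero_le hx1'.le).trans (hT i), hST⟩

/-- The upper bounds `c i ≤ MmS i` make the scheduling optimum at least `lam`; the lower bounds `α *
MmS i ≤ c i` turn the schedule back into a guarantee. -/
theorem IsRun.solvesMaxMin {r : Run N M} (h : IsRun u ε r) {lam : ℝ≥0∞} {S : M → Fin N}
    (hS : SolvesMaxMin u lam S) : SolvesMaxMin u ((1 - (ε : ℝ≥0∞)) * lam) r.S := by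
  obtain ⟨⟨hα, -⟩, -, hαβ, hc, hT⟩ := h
  intro i
  rcases eq_zero_or_pos (r.c i) with hi | hi
  · have h₁ := (hc i).1
    rw [hi, nonpos_iff_eq_zero, mul_eq_zero] at h₁
    simp [h₁.resolve_left hα.ne']
  · obtain ⟨T, hT, hST⟩ := hT ⟨i, hi⟩
    -- A positive share forces `MmS i > 0`, and no finite bundle reaches an infinite multiple of it.
    have hlam : lam ≠ ∞ := by
      rintro rfl
      have h₁ := hS i
      rw [ENNReal.top_mul (by simpa using (hi.trans_le (hc i).2).ne')] at h₁
      exact ENNReal.coe_ne_top (top_le_iff.1 h₁)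
    lift lam to ℝ≥0 using hlam
    have hε : (1 : ℝ≥0) - ε ≤ r.α * r.β := by
      rw [tsub_le_iff_right, ← NNReal.coe_le_coe]
      push_cast
      linarith
    have : Nonempty {i : Fin N // 0 < r.c i} := ⟨⟨i, hi⟩⟩
    have hopt : lam ≤ cMin fun (i : {i : Fin N // 0 < r.c i}) j => 1 / r.c i * u i j := by
      classical
      -- Items of inactive agents all go to the active agent `i`; bundles of active agents only
      -- grow.
      refine le_cMin (T := fun j => if h : 0 < r.c (S j) then ⟨S j, h⟩ else ⟨i, hi⟩) fun k => ?_
      rw [value_const_mul, one_div, ← div_eq_inv_mul, le_div_iff₀ k.2]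
      have h₁ : lam * mms u k ≤ value (u k) (bundle S k) := by exact_mod_cast hS k
      refine (mul_le_mul_right (hc k).2 lam).trans (h₁.trans ?_)
      refine sum_le_sum_of_subset fun j hj => ?_
      simp only [bundle, mem_filter, mem_univ, true_and] at hj ⊢
      have hk := k.2
      rw [← hj] at hk
      rw [dif_pos hk]
      exact Subtype.ext hj
    have h₁ := (mul_le_mul_right hopt r.β).trans (hT ⟨i, hi⟩)
    rw [value_const_mul, one_div, ← div_eq_inv_mul, le_div_iff₀ hi] at h₁
    have h₂ : bundle T ⟨i, hi⟩ = bundle r.S i := by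
      ext j
      simp [bundle, hST, Subtype.ext_iff]
    rw [h₂] at h₁
    have h₃ : (1 - ε) * lam * mms u i ≤ value (u i) (bundle r.S i) := by
      calc (1 - ε) * lam * mms u i ≤ r.α * r.β * lam * mms u i := by gcongr
        _ = r.β * lam * (r.α * mms u i) := by ring
        _ ≤ r.β * lam * r.c i := by gcongr; exact (hc i).1
        _ ≤ _ := h₁
    exact_mod_cast h₃

theorem IsMmSAllocation.solvesMaxMin {S : M → Fin N} (hS : IsMmSAllocation u S) :
    SolvesMaxMin u 1 S := fun i => by
  rw [one_mul]
  exact_mod_cast hS i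

end Approximation

/-! ### The program computes an execution -/

section Link

variable {N m K : ℕ} {a : ℕ → ℕ} {u : Fin N → Fin m → ℚ≥0}

/-- `a` holds the utilities `u`. -/
structure Holds (a : ℕ → ℕ) (u : Fin N → Fin m → ℚ≥0) : Prop where
  num : ∀ (i : Fin N) (j : Fin m), a (2 * ((i : ℕ) * m + j) + 3) = (u i j).num
  den : ∀ (i : Fin N) (j : Fin m), a (2 * ((i : ℕ) * m + j) + 4) = (u i j).den

/-- An assignment of items as a function on the natural numbers. -/
def extend {ι : Type*} (f : ι → ℕ) (T : Fin m → ι) (j : ℕ) : ℕ :=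
  if h : j < m then f (T ⟨j, h⟩) else 0

/-- The bridge from integer loads to real values, up to a common scale `D`. The numbering `f` allows
the machines to be all agents or only the active ones. -/
theorem load_eq_value {ι : Type*} [DecidableEq ι] {f : ι → ℕ} (hf : Function.Injective f)
    {p : ℕ → ℕ → ℕ} {s : ℕ → ℕ} {T : Fin m → ι} (hs : ∀ j : Fin m, s j = f (T j)) {v : Fin m → ℝ≥0}
    {D : ℝ≥0} {i : ι} (hv : ∀ j : Fin m, (p (f i) j : ℝ≥0) = D * v j) :
    (load p s m (f i) : ℝ≥0) = D * value v (bundle T i) := by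
  rw [load, value, bundle, mul_sum, sum_filter, Nat.cast_sum,
    ← Fin.sum_univ_eq_sum_range (fun j => ((if s j = f i then p (f i) j else 0 : ℕ) : ℝ≥0))]
  refine sum_congr rfl fun j _ => ?_
  simp only [hs, hf.eq_iff]
  split_ifs
  · exact hv j
  · simp

theorem le_minLoad_of_le {P n : ℕ} {b s : ℕ → ℕ} {x : ℝ≥0} (hP : x ≤ P)
    (hs : ∀ i < n, b i ≠ 0 → x ≤ s i) : x ≤ minLoad P b s n := by
  rw [← Nat.ceil_le, le_minLoad_iff]
  exact ⟨Nat.ceil_le.2 hP, fun i hi hb => Nat.ceil_le.2 (hs i hi hb)⟩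

theorem index_lt (i : Fin N) (j : Fin m) : (i : ℕ) * m + j < N * m := by
  have h₁ : ((i : ℕ) + 1) * m ≤ N * m := Nat.mul_le_mul_right _ i.2
  have h₂ := j.2
  rw [add_mul] at h₁
  omega

/-- The integer division in `scaled` is exact, as each denominator divides the product of all. -/
theorem scaled_cast (hu : Holds a u) (ha : ValidInput N m K a) (i : Fin N) (j : Fin m) :
    (scaled a N m i j : ℝ≥0) = denProd a (N * m) * toReal u i j := by
  have h₁ : a (2 * ((i : ℕ) * m + j) + 4) ∣ denProd a (N * m) :=
    dvd_prod_of_mem (fun k => a (2 * k + 4)) (mem_range.2 (index_lt i j))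
  have h₂ : (a (2 * ((i : ℕ) * m + j) + 4) : ℝ≥0) ≠ 0 := by
    exact_mod_cast ha.den _ (index_lt i j)
  rw [scaled, Nat.cast_mul, Nat.cast_div h₁ h₂, hu.num, hu.den, toReal, NNRat.cast_def]
  ring

theorem denProd_pos (ha : ValidInput N m K a) : (0 : ℝ≥0) < denProd a (N * m) := by
  exact_mod_cast Nat.pos_of_ne_zero (prod_ne_zero_iff.2 fun k hk => ha.den k (mem_range.1 hk))

theorem accuracy_cast (ha : ValidInput N m K a) : ((K - 1 : ℕ) : ℝ≥0) / K * K = (K - 1 : ℕ) :=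
  div_mul_cancel₀ _ (by exact_mod_cast ha.accuracy_pos.ne')

theorem IsShare.isShare_real {r : Fin N} {c : ℕ} (h : IsShare N m K a r c) (hu : Holds a u)
    (ha : ValidInput N m K a) :
    ((K - 1 : ℕ) : ℝ≥0) / K * mms (toReal u) r ≤ (c : ℝ≥0) / denProd a (N * m) ∧
      (c : ℝ≥0) / denProd a (N * m) ≤ mms (toReal u) r := by
  have : Nonempty (Fin N) := ⟨⟨0, ha.agents⟩⟩
  have hD := denProd_pos ha
  have hKpos : (0 : ℝ≥0) < K := by exact_mod_cast ha.accuracy_pos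
  obtain ⟨⟨S, hS, hc⟩, hT⟩ := h
  have hload : ∀ {s : ℕ → ℕ} {T : Fin m → Fin N}, (∀ j : Fin m, s j = T j) → ∀ k : Fin N,
      (load (fun _ => scaled a N m r) s m k : ℝ≥0) =
        denProd a (N * m) * value (toReal u r) (bundle T k) := fun hs k =>
    load_eq_value Fin.val_injective hs fun j => scaled_cast hu ha r j
  constructor
  -- On identical machines `cMin` is `mms` by definition.
  · obtain ⟨T, hTm⟩ := exists_cMin_le (fun _ : Fin N => toReal u r)
    have hs : ∀ j : Fin m, extend Fin.val T j = T j := fun j => by simp [extend]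
    have hfeas : Feasible N (fun _ => 1) m (extend Fin.val T) := fun j hj =>
      ⟨by rw [hs ⟨j, hj⟩]; exact (T ⟨j, hj⟩).2, one_ne_zero⟩
    have h₁ : ∀ k < N, denProd a (N * m) * mms (toReal u) r ≤
        (load (fun _ => scaled a N m r) (extend Fin.val T) m k : ℝ≥0) := fun k hk => by
      rw [hload hs ⟨k, hk⟩]
      exact mul_le_mul_right (hTm _) _
    have h₂ : denProd a (N * m) * mms (toReal u) r ≤
        (minLoad (sizeBound a (N * m)) (fun _ => 1)
          (load (fun _ => scaled a N m r) (extend Fin.val T) m) N : ℝ≥0) := by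
      -- The cap in `minLoad` is harmless: the share is bounded by the load of machine `0`, which is
      -- below the cap.
      refine le_minLoad_of_le ((h₁ 0 ha.agents).trans ?_) fun k hk _ => h₁ k hk
      have h₃ : load (fun _ => scaled a N m r) (extend Fin.val T) m 0 ≤ sizeBound a (N * m) :=
        (load_le _ _ m 0).trans (sum_scaled_le r.2)
      exact_mod_cast h₃
    have h₃ : ((K - 1 : ℕ) : ℝ≥0) * (minLoad (sizeBound a (N * m)) (fun _ => 1)
          (load (fun _ => scaled a N m r) (extend Fin.val T) m) N : ℝ≥0) ≤ K * c := by
      exact_mod_cast hT _ hfeas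
    rw [le_div_iff₀ hD, ← mul_le_mul_iff_right₀ hKpos]
    calc (K : ℝ≥0) * (((K - 1 : ℕ) : ℝ≥0) / K * mms (toReal u) r * denProd a (N * m))
        = ((K - 1 : ℕ) : ℝ≥0) / K * K * (denProd a (N * m) * mms (toReal u) r) := by ring
      _ ≤ K * c := by
        rw [accuracy_cast ha]
        exact (mul_le_mul_right h₂ _).trans h₃
  · refine le_cMin (T := fun j => ⟨S j, (hS j j.2).1⟩) fun k => ?_
    rw [div_le_iff₀' hD, ← hload (s := S) (fun j => rfl) k]
    exact_mod_cast (le_minLoad_iff.1 hc.le).2 k k.2 one_ne_zero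

theorem shareProd_pos (c : ℕ → ℕ) (N : ℕ) : 0 < shareProd c N :=
  prod_pos fun i _ => by omega

/-- The factor `shareProd c N` is the same for all active agents, so integer loads compare like the
real relative utilities. The common denominator of utilities and shares cancels. -/
theorem relative_cast (hu : Holds a u) (ha : ValidInput N m K a) {c : ℕ → ℕ} {i : Fin N}
    (hc : c i ≠ 0) (j : Fin m) : (relative a N m c i j : ℝ≥0) =
      shareProd c N * (1 / ((c i : ℝ≥0) / denProd a (N * m)) * toReal u i j) := by
  have h₁ : c i ∣ shareProd c N := by
    have := dvd_prod_of_mem (fun i => c i + (1 - c i)) (mem_range.2 i.2)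
    rwa [show c i + (1 - c i) = c i by omega] at this
  have h₂ : (c i : ℝ≥0) ≠ 0 := by exact_mod_cast hc
  have h₃ := (denProd_pos ha).ne'
  rw [relative, Nat.cast_mul, Nat.cast_div h₁ h₂, scaled_cast hu ha]
  field_simp

theorem IsSchedule.isSchedule_real {c S : ℕ → ℕ} (h : IsSchedule N m K a c S) (hu : Holds a u)
    (ha : ValidInput N m K a) {r : Run N (Fin m)}
    (hc : ∀ i : Fin N, r.c i = (c i : ℝ≥0) / denProd a (N * m)) (hS : ∀ j : Fin m, S j = r.S j)
    (hA : ∃ i, 0 < r.c i) :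
    ∃ T : Fin m → {i : Fin N // 0 < r.c i},
      (∀ i : {i : Fin N // 0 < r.c i}, ((K - 1 : ℕ) : ℝ≥0) / K *
          cMin (fun (i : {i : Fin N // 0 < r.c i}) j => 1 / r.c i * toReal u i j) ≤
        value (fun j => 1 / r.c i * toReal u i j) (bundle T i)) ∧ ∀ j, r.S j = (T j : Fin N) := by
  have hD := denProd_pos ha
  have hKpos : (0 : ℝ≥0) < K := by exact_mod_cast ha.accuracy_pos
  have hE : (0 : ℝ≥0) < shareProd c N := by exact_mod_cast shareProd_pos c N
  have hpos : ∀ i : Fin N, 0 < r.c i ↔ c i ≠ 0 := fun i => by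
    rw [hc i, div_pos_iff_of_pos_right hD, Nat.cast_pos, Nat.pos_iff_ne_zero]
  obtain ⟨i₀, hi₀⟩ := hA
  have : Nonempty {i : Fin N // 0 < r.c i} := ⟨⟨i₀, hi₀⟩⟩
  set p := fun (i : {i : Fin N // 0 < r.c i}) j => 1 / r.c i * toReal u i j with hp
  let f : {i : Fin N // 0 < r.c i} → ℕ := fun i => (i : Fin N)
  have hf : Function.Injective f := Fin.val_injective.comp Subtype.val_injective
  have hload : ∀ {s : ℕ → ℕ} {T : Fin m → {i : Fin N // 0 < r.c i}}, (∀ j : Fin m, s j = f (T j)) →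
      ∀ k, (load (relative a N m c) s m (f k) : ℝ≥0) =
        shareProd c N * value (p k) (bundle T k) := fun hs k =>
    load_eq_value hf hs fun j => by
      rw [hp]
      simp only [f]
      rw [relative_cast hu ha ((hpos k).1 k.2), hc k]
  obtain ⟨T, hT⟩ := exists_cMin_le p
  have hs : ∀ j : Fin m, extend f T j = f (T j) := fun j => by simp [extend]
  have hfeas : Feasible N c m (extend f T) := fun j hj => by
    rw [hs ⟨j, hj⟩]
    exact ⟨(T ⟨j, hj⟩).1.2, (hpos _).1 (T ⟨j, hj⟩).2⟩
  obtain ⟨hSf, h₁⟩ := h.2 _ hfeas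
  have hSpos : ∀ j, 0 < r.c (r.S j) := fun j => by
    have := (hSf j j.2).2
    rw [hS j] at this
    exact (hpos _).2 this
  have h₂ : ∀ k, shareProd c N * cMin p ≤
      (load (relative a N m c) (extend f T) m (f k) : ℝ≥0) := fun k => by
    rw [hload hs k]
    exact mul_le_mul_right (hT k) _
  have h₃ : shareProd c N * cMin p ≤ (minLoad (sizeBound a (N * m) * shareProd c N) c
      (load (relative a N m c) (extend f T) m) N : ℝ≥0) := by
    refine le_minLoad_of_le ((h₂ ⟨i₀, hi₀⟩).trans ?_) fun k hk hck =>
      h₂ ⟨⟨k, hk⟩, (hpos _).2 hck⟩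
    exact_mod_cast (load_le _ _ m _).trans (sum_relative_le c i₀.2)
  refine ⟨fun j => ⟨r.S j, hSpos j⟩, fun k => ?_, fun j => rfl⟩
  have h₄ : ((K - 1 : ℕ) : ℝ≥0) * (minLoad (sizeBound a (N * m) * shareProd c N) c
      (load (relative a N m c) (extend f T) m) N : ℝ≥0) ≤
      K * load (relative a N m c) S m (f k) := by
    exact_mod_cast h₁.trans (Nat.mul_le_mul_left _
      ((le_minLoad_iff.1 le_rfl).2 k k.1.2 ((hpos k).1 k.2)))
  rw [hload (T := fun j => ⟨r.S j, hSpos j⟩) hS k] at h₄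
  rw [← mul_le_mul_iff_right₀ hE, ← mul_le_mul_iff_right₀ hKpos]
  calc (K : ℝ≥0) * (shareProd c N * (((K - 1 : ℕ) : ℝ≥0) / K * cMin p))
      = ((K - 1 : ℕ) : ℝ≥0) / K * K * (shareProd c N * cMin p) := by ring
    _ ≤ _ := by
      rw [accuracy_cast ha]
      exact (mul_le_mul_right h₃ _).trans h₄

end Link

/-! ### Input size -/

theorem getD_flatMap {α : Type*} {f : α → List ℕ} {c : ℕ} (hf : ∀ x, (f x).length = c)
    (l : List α) {i r : ℕ} (hi : i < l.length) (hr : r < c) :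
    (l.flatMap f).getD (i * c + r) 0 = (f l[i]).getD r 0 := by
  induction l generalizing i with
  | nil => simp at hi
  | cons x l ih =>
    rw [List.flatMap_cons]
    cases i with
    | zero =>
      rw [List.getD_append _ _ _ _ (by rw [hf]; omega)]
      simp
    | succ i =>
      rw [List.getD_append_right _ _ _ _ (by rw [hf, add_mul]; omega), hf,
        show (i + 1) * c + r - c = i * c + r by rw [add_mul]; omega]
      simpa using ih (by simpa using hi)

section Encode

variable {N m : ℕ} (ε : ℚ≥0) (u : Fin N → Fin m → ℚ≥0)

theorem length_encode : (encode ε u).length = 2 * (N * m) + 3 := by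
  simp [encode]
  ring

/-- Constant block lengths, `2 * m` per agent and `2` per item, locate each entry; `r` selects
numerator or denominator. -/
theorem initState_encode_add_three (i : Fin N) (j : Fin m) {r : ℕ} (hr : r < 2) :
    initState (encode ε u) 0 (2 * ((i : ℕ) * m + j) + 3 + r) =
      [(u i j).num, (u i j).den].getD r 0 := by
  have hj := j.2
  have h₁ : (j : ℕ) * 2 + r < m * 2 := by omega
  rw [initState, if_pos rfl, encode, List.getD_append_right _ _ _ _ (by simp; omega)]
  have h₂ : 2 * ((i : ℕ) * m + j) + 3 + r - [ε.num, ε.den, m].length =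
      i * (m * 2) + (j * 2 + r) := by
    simp only [List.length_cons, List.length_nil]
    rw [← mul_assoc]
    omega
  rw [h₂, getD_flatMap (c := m * 2) (by simp) _ (by simp) h₁,
    getD_flatMap (c := 2) (by simp) _ (by simp) hr]
  simp

theorem holds_encode : Holds (initState (encode ε u) 0) u where
  num i j := by simpa using initState_encode_add_three ε u i j (r := 0) (by norm_num)
  den i j := by simpa using initState_encode_add_three ε u i j (r := 1) (by norm_num)

theorem validInput_encode (hN : 0 < N) :
    ValidInput N m (2 * ε.den) (initState (encode ε u) 0) where
  agents := hN
  accuracy := rfl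
  accuracy_pos := by have := ε.den_pos; omega
  items := rfl
  den k hk := by
    have hm : 0 < m := Nat.pos_of_ne_zero fun h => by simp [h] at hk
    -- The `k`-th utility belongs to agent `k / m` and item `k % m`.
    have h := (holds_encode ε u).den ⟨k / m, Nat.div_lt_of_lt_mul (by rwa [mul_comm])⟩
      ⟨k % m, Nat.mod_lt k hm⟩
    simp only [Nat.div_add_mod'] at h
    rw [h]
    exact NNRat.den_ne_zero _

theorem length_le_inputSize (L : List ℕ) : L.length ≤ inputSize L := by
  simpa [inputSize] using List.card_nsmul_le_sum (L.map bits) 1 (by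
    intro x hx
    obtain ⟨y, -, rfl⟩ := List.mem_map.1 hx
    exact bits_pos y)

theorem bounded_initState (L : List ℕ) : Bounded (inputSize L) (initState L) := by
  intro a k
  unfold initState
  split_ifs
  · rw [List.getD_eq_getElem?_getD]
    by_cases hk : k < L.length
    · rw [List.getElem?_eq_getElem hk, Option.getD_some]
      have h₁ : bits L[k] ≤ inputSize L :=
        List.single_le_sum (by simp) _ (List.mem_map_of_mem (List.getElem_mem hk))
      exact (Nat.lt_size_self _).trans_le
        (Nat.pow_le_pow_right (by norm_num) ((Nat.le_succ _).trans h₁))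
    · rw [List.getElem?_eq_none (by omega)]
      simp
  · positivity

end Encode

/-! ### The running time -/

/-- Bound for the number of cells of a layer of the table. -/
def layerBound (N K L : ℕ) : ℕ := (L * (2 * L * K) + 1) ^ N

/-- Bound for the bit length of the bound on loads. -/
def loadBits (N L : ℕ) : ℕ := L * (2 * L) * (N + 1) + 2

/-- Bound for the bit length of all numbers. -/
def bitBound (N K L : ℕ) : ℕ :=
  (L + 1) * layerBound N K L + loadBits N L * N + N * L + loadBits N L + K + L + 1

/-- Bound for the number of steps of the max-min subroutine. -/
def callBound (N K L : ℕ) : ℕ :=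
  1 + (1 + (loadBits N L * ((L + 1) * layerBound N K L * 4 + 3 +
    (layerBound N K L * 4 + 3 + 1 + 1) + 1 + 1) + 1) + 1) + 1

/-- Bound for the number of steps of the program. -/
def schemeBound (N K L : ℕ) : ℕ :=
  13 + ((L * 8 + 3) + ((N * (callBound N K L + 5) + 1) +
    (callBound N K L + (L * 4 + 3) + 1) + 1) + 1) + 1

section Bounds

variable {N m K L : ℕ} {a : ℕ → ℕ}

/-- The product has at most `L` factors, each at most `2 ^ (2 * L)`; the two extra bits in
`loadBits` pay for the added one and the doubling. -/
theorem sizeBound_pow_lt (ha : ∀ k, a k < 2 ^ L) (hL : N * m ≤ L) :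
    2 * (sizeBound a (N * m) ^ (N + 1) + 1) ≤ 2 ^ loadBits N L := by
  have h₁ : sizeBound a (N * m) ≤ 2 ^ (L * (2 * L)) := by
    refine (prod_le_pow_card _ _ (2 ^ (2 * L)) fun k _ => ?_).trans ?_
    · rw [two_mul L, pow_add]
      exact Nat.mul_le_mul (ha _) (ha _).le
    · rw [card_range, ← pow_mul, mul_comm]
      exact Nat.pow_le_pow_right (by norm_num) (Nat.mul_le_mul_right _ hL)
  have h₂ := Nat.pow_le_pow_left h₁ (N + 1)
  rw [← pow_mul] at h₂
  have h₃ : 1 ≤ 2 ^ (L * (2 * L) * (N + 1)) := Nat.one_le_two_pow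
  rw [loadBits, pow_add 2]
  omega

theorem layer_le (hm : m ≤ L) : MaxMinInput.layer N m K ≤ layerBound N K L := by
  unfold MaxMinInput.layer layerBound
  gcongr

theorem suffices_bitBound (hN : 0 < N) (ha : ∀ k, a k < 2 ^ L) (hL : N * m ≤ L) :
    Suffices N m K a (bitBound N K L) := by
  have hm : m ≤ L := (Nat.le_mul_of_pos_left m hN).trans hL
  have hpow := sizeBound_pow_lt ha hL
  have hlayer := layer_le (N := N) (K := K) hm
  have lt_of_le : ∀ {x n : ℕ}, x ≤ 2 ^ n → n < bitBound N K L → x < 2 ^ bitBound N K L :=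
    fun h₁ h₂ => h₁.trans_lt (Nat.pow_lt_pow_right (by norm_num) h₂)
  have hNL : N ^ (N * m) ≤ 2 ^ (N * L) :=
    (Nat.pow_le_pow_right hN hL).trans
      ((Nat.pow_le_pow_left Nat.lt_two_pow_self.le _).trans (by rw [← pow_mul]))
  refine ⟨⟨?_, ?_, ?_⟩, ?_, ?_, ?_⟩
  · refine lt_of_le (n := (L + 1) * layerBound N K L) ?_ (by unfold bitBound; omega)
    -- The number of cells is itself polynomial, so the wasteful `x < 2 ^ x` suffices.
    exact (Nat.mul_le_mul (by omega) hlayer).trans Nat.lt_two_pow_self.le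
  · refine lt_of_le (n := loadBits N L * N + N * L) ?_ (by unfold bitBound; omega)
    rw [pow_add 2, pow_mul 2]
    refine Nat.mul_le_mul (Nat.pow_le_pow_left (by omega) _) (le_trans ?_ hNL)
    exact Nat.pow_le_pow_right hN (Nat.le_mul_of_pos_left m hN)
  · exact lt_of_le hpow (by unfold bitBound; omega)
  · exact lt_of_le Nat.lt_two_pow_self.le (by unfold bitBound; omega)
  · exact lt_of_le (hL.trans Nat.lt_two_pow_self.le) (by unfold bitBound; omega)
  · exact lt_of_le hNL (by unfold bitBound; omega)

theorem schemeSteps_le (hN : 0 < N) (ha : ∀ k, a k < 2 ^ L) (hL : N * m ≤ L) :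
    schemeSteps N m K a ≤ schemeBound N K L := by
  have hm : m ≤ L := (Nat.le_mul_of_pos_left m hN).trans hL
  have hlayer := layer_le (N := N) (K := K) hm
  have hsize : Nat.size (sizeBound a (N * m) ^ (N + 1) + 1) ≤ loadBits N L := by
    rw [Nat.size_le]
    have := sizeBound_pow_lt ha hL
    omega
  have hcall : callSteps N m K a ≤ callBound N K L := by
    unfold callSteps MaxMinInput.steps callBound MaxMinInput.passSteps
    gcongr
  unfold schemeSteps schemeBound
  gcongr

/-- The function is given by a polynomial. -/
def IsPoly (f : ℕ → ℕ) : Prop := ∃ q : Polynomial ℕ, ∀ x, q.eval x = f x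

namespace IsPoly

variable {f g : ℕ → ℕ}

theorem const (c : ℕ) : IsPoly fun _ => c := ⟨.C c, fun x => by simp⟩

theorem id : IsPoly fun x => x := ⟨.X, fun x => by simp⟩

theorem add : IsPoly f → IsPoly g → IsPoly fun x => f x + g x
  | ⟨p, hp⟩, ⟨q, hq⟩ => ⟨p + q, fun x => by simp [hp, hq]⟩

theorem mul : IsPoly f → IsPoly g → IsPoly fun x => f x * g x
  | ⟨p, hp⟩, ⟨q, hq⟩ => ⟨p * q, fun x => by simp [hp, hq]⟩

theorem pow (n : ℕ) : IsPoly f → IsPoly fun x => f x ^ n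
  | ⟨p, hp⟩ => ⟨p ^ n, fun x => by simp [hp]⟩

end IsPoly

/-- Here `N` occurs as an exponent and `K` as a coefficient; the bound is a polynomial in `L`
because both are constants. -/
theorem isPoly_time (N K w : ℕ) :
    IsPoly fun L => schemeBound N K L * w * (bitBound N K L + 1) ^ 2 := by
  have hlayer : IsPoly fun L => layerBound N K L :=
    ((IsPoly.id.mul (((IsPoly.const 2).mul .id).mul (.const K))).add (.const 1)).pow N
  have hload : IsPoly fun L => loadBits N L :=
    ((IsPoly.id.mul ((IsPoly.const 2).mul .id)).mul (.const (N + 1))).add (.const 2)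
  have hcells := (IsPoly.id.add (.const 1)).mul hlayer
  have hbit : IsPoly fun L => bitBound N K L :=
    (((((hcells.add (hload.mul (.const N))).add ((IsPoly.const N).mul .id)).add hload).add
      (.const K)).add .id).add (.const 1)
  have hpass := (((hcells.mul (.const 4)).add (.const 3)).add
    ((((hlayer.mul (.const 4)).add (.const 3)).add (.const 1)).add (.const 1))).add (.const 1)
  have hcall : IsPoly fun L => callBound N K L :=
    ((IsPoly.const 1).add (((IsPoly.const 1).add ((hload.mul (hpass.add (.const 1))).add
      (.const 1))).add (.const 1))).add (.const 1)
  have hscheme : IsPoly fun L => schemeBound N K L :=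
    ((IsPoly.const 13).add ((((IsPoly.id.mul (.const 8)).add (.const 3)).add
      (((((IsPoly.const N).mul (hcall.add (.const 5))).add (.const 1)).add
        ((hcall.add ((IsPoly.id.mul (.const 4)).add (.const 3))).add (.const 1))).add
        (.const 1))).add (.const 1))).add (.const 1)
  exact (hscheme.mul (.const w)).mul ((hbit.add (.const 1)).pow 2)

end Bounds

/-! ### The approximation scheme -/

/-- A positive rational is at least the reciprocal `1 / d` of its denominator, and `(1 - 1 / (2 *
d)) ^ 2 > 1 - 1 / d`. -/
theorem one_sub_lt_accuracy_sq {ε : ℚ≥0} (hε : 0 < ε) :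
    1 - ((ε : ℝ≥0) : ℝ) < (((2 * ε.den - 1 : ℕ) : ℝ≥0) / (2 * ε.den : ℕ) : ℝ≥0) *
      (((2 * ε.den - 1 : ℕ) : ℝ≥0) / (2 * ε.den : ℕ) : ℝ≥0) := by
  have hd : 0 < ε.den := ε.den_pos
  have hd' : (0 : ℝ) < ε.den := by exact_mod_cast hd
  have hn : (1 : ℝ) ≤ ε.num := by exact_mod_cast NNRat.num_pos.2 hε
  have h₁ : ((ε : ℝ≥0) : ℝ) = ε.num / ε.den := by
    rw [NNRat.cast_def]
    push_cast
    rfl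
  have h₂ : 1 / (ε.den : ℝ) ≤ ε.num / ε.den := by gcongr
  have h₃ : ((2 * ε.den - 1 : ℕ) : ℝ) = 2 * ε.den - 1 := by
    rw [Nat.cast_sub (by omega)]
    push_cast
    rfl
  rw [h₁, NNReal.coe_div, NNReal.coe_natCast, NNReal.coe_natCast, h₃]
  push_cast
  have h₄ : (2 * (ε.den : ℝ) - 1) / (2 * ε.den) * ((2 * (ε.den : ℝ) - 1) / (2 * ε.den)) =
      1 - 1 / ε.den + 1 / (4 * ε.den * ε.den) := by
    field_simp
    ring
  rw [h₄]
  have h₅ : (0 : ℝ) < 1 / (4 * ε.den * ε.den) := by positivity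
  linarith

theorem implementsInPolyTime_scheme {N : ℕ} (hN : 0 < N) :
    ImplementsInPolyTime N (Prog.scheme N) := by
  intro ε hε
  obtain ⟨q, hq⟩ := isPoly_time N (2 * ε.den) (Prog.scheme N).weight
  refine ⟨q, fun m u => ?_⟩
  set L := inputSize (encode ε u) with hL
  have hlen : N * m ≤ L := by
    have h₁ := length_le_inputSize (encode ε u)
    rw [length_encode] at h₁
    omega
  have hbound := bounded_initState (encode ε u)
  rw [← hL] at hbound
  have hvalid := validInput_encode ε u hN
  have hu := holds_encode ε u
  have hLB : L ≤ bitBound N (2 * ε.den) L := by unfold bitBound; omega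
  obtain ⟨σ, t, hexec, ht, -, hready, hshare, hsched⟩ := (reaches_scheme hvalid
    (suffices_bitBound hN (hbound 0) hlen)
    (fun b k => (hbound b k).trans_le (Nat.pow_le_pow_right (by norm_num) hLB)) rfl).mono
      (schemeSteps_le hN (hbound 0) hlen)
  refine ⟨σ, t, hexec, ht.trans_eq (hq L).symm, ?_⟩
  set a := initState (encode ε u) 0
  set K := 2 * ε.den with hK
  have hden : ε.den ≠ 0 := ε.den_ne_zero
  have hD := denProd_pos hvalid
  let x : ℝ≥0 := ((K - 1 : ℕ) : ℝ≥0) / K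
  have hx : (0 < x ∧ x < 1) := by
    have h₁ : (0 : ℝ≥0) < K := by exact_mod_cast hvalid.accuracy_pos
    refine ⟨div_pos (by exact_mod_cast (by omega : 0 < K - 1)) h₁, ?_⟩
    rw [div_lt_one h₁]
    exact_mod_cast (by omega : K - 1 < K)
  let r : Run N (Fin m) :=
    ⟨x, x, fun i => (σ 1 (2 * i + 4) : ℝ≥0) / denProd a (N * m), fun j => ⟨σ 2 j, hsched.1 j j.2⟩⟩
  refine ⟨r, ⟨hx, hx, one_sub_lt_accuracy_sq hε, fun i => (hshare i i.2).1.isShare_real hu hvalid,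
    fun hA => hsched.isSchedule_real hu hvalid (r := r) (fun i => rfl) (fun j => rfl) hA⟩,
    fun k hk => ?_, ?_, ?_, fun i => ?_, fun j => rfl⟩
  · rcases k with _ | _ | k
    · rw [show 2 * 0 + 1 = 1 by rfl, hready.alpha.2]
      omega
    · rw [show 2 * (0 + 1) + 1 = 3 by rfl, hready.beta.2]
      omega
    · rw [show 2 * (k + 1 + 1) + 1 = 2 * k + 5 by ring, (hshare k (by omega)).2]
      exact_mod_cast hD.ne'
  · simp [r, x, frac, hready.alpha]
  · simp [r, x, frac, hready.beta]
  · simp only [r, frac]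
    rw [show 2 * ((i : ℕ) + 2) = 2 * i + 4 by ring,
      show 2 * (i : ℕ) + 4 + 1 = 2 * i + 5 by ring, (hshare i i.2).2]

/-- By `IsRun.solvesMaxMin`, a single execution competes with every attainable ratio at once, so the
program need not know the target. -/
theorem ImplementsInPolyTime.isPTAS {N : ℕ} {P : Prog} (h : ImplementsInPolyTime N P)
    {C : ∀ m : ℕ, (Fin N → Fin m → ℝ≥0) → Prop}
    {target : ∀ m : ℕ, (Fin N → Fin m → ℝ≥0) → ℝ≥0∞}
    (hC : ∀ m u, C m u → ∃ S : Fin m → Fin N, SolvesMaxMin u (target m u) S) :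
    IsPTAS N P C target := by
  intro ε hε
  obtain ⟨q, hq⟩ := h ε hε
  refine ⟨q, fun m u hu => ?_⟩
  obtain ⟨σ, t, hexec, ht, r, hr, hout⟩ := hq m u
  obtain ⟨S, hS⟩ := hC m _ hu
  exact ⟨σ, t, hexec, ht, r.S, hout.2.2.2.2, hr.solvesMaxMin hS⟩

end GoodsMmS

theorem mainTheorem6 (N : ℕ) (hN : 0 < N) :
    (∀ (M : Type*) [Fintype M] (u : Fin N → M → ℝ≥0) (ε : ℝ≥0), 0 < ε →
      (∃ r : GoodsMmS.Run N M, GoodsMmS.IsRun u ε r) ∧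
      ∀ r : GoodsMmS.Run N M, GoodsMmS.IsRun u ε r →
        GoodsMmS.SolvesMaxMin u ((1 - (ε : ℝ≥0∞)) * GoodsMmS.optRatio u) r.S ∧
        ((∃ S : M → Fin N, GoodsMmS.IsMmSAllocation u S) →
          GoodsMmS.SolvesMaxMin u (1 - (ε : ℝ≥0∞)) r.S)) ∧
    ∃ P : GoodsMmS.Prog,
      GoodsMmS.ImplementsInPolyTime N P ∧
      GoodsMmS.IsPTAS N P (fun _ _ => True) (fun _ u => GoodsMmS.optRatio u) ∧
      GoodsMmS.IsPTAS N P (fun _ u => ∃ S, GoodsMmS.IsMmSAllocation u S) (fun _ _ => 1) := by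
  refine ⟨fun M _ u ε hε => ⟨GoodsMmS.exists_isRun hN u hε, fun r hr => ⟨?_, ?_⟩⟩,
    GoodsMmS.Prog.scheme N, GoodsMmS.implementsInPolyTime_scheme hN, ?_, ?_⟩
  · obtain ⟨S, hS⟩ := (GoodsMmS.optRatio_isGreatest hN u).1
    exact hr.solvesMaxMin hS
  · rintro ⟨S, hS⟩
    simpa only [mul_one] using hr.solvesMaxMin hS.solvesMaxMin
  · exact (GoodsMmS.implementsInPolyTime_scheme hN).isPTAS fun m u _ =>
      (GoodsMmS.optRatio_isGreatest hN u).1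
  · exact (GoodsMmS.implementsInPolyTime_scheme hN).isPTAS fun m u ⟨S, hS⟩ =>
      ⟨S, hS.solvesMaxMin⟩
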